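/- Let $K$ be a field of characteristic zero, $n\ge 0$ and $P_n=K[x_1,\dots,x_n]$. Inside $\mathrm{End}_K(P_n)$ let $A_n=K\langle x_i,\partial_i\rangle$ be the $n$-th Weyl algebra and $\mathbb I_n=K\langle x_i,\partial_i,\int_i\rangle$ $(1\le i\le n)$ the algebra of polynomial integro-differential operators, where $\partial_i=\partial/\partial x_i$ and $\int_i x^\alpha=(\alpha_i+1)^{-1}x_ix^\alpha$. Put $H_i=\partial_ix_i$ and $e_{st}(i)=\int_i^s\partial_i^t-\int_i^{s+1}\partial_i^{t+1}$ for $s,t\in\mathbb N$; let $F_n=\bigoplus_{\alpha,\beta\in\mathbb N^n}K\prod_{i}e_{\alpha_i\beta_i}(i)$, let $\mathfrak a_n$ be the ideal of $\mathbb I_n$ generated by all $e_{st}(i)$, let $B_n=\mathbb I_n/\mathfrak a_n$ with canonical map $a\mapsto\overline a$, and let $\Delta_n=K\langle H_1,\dots,H_n,\partial_1,\dots,\partial_n\rangle\subseteq\mathbb I_n$ (a skew polynomial ring, which embeds in $B_n$). For a ring $R$, a multiplicative set is a subset $S$ with $1\in S$, $SS\subseteq S$, $0\notin S$. It is a left denominator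 set if $Sr\cap Rs\ne\emptyset$ for all $r\in R$, $s\in S$, and $rs=0$ with $s\in S$ implies $tr=0$ for some $t\in S$; then $S^{-1}R$ denotes the left quotient ring. Multiplicative sets $S\subseteq T$ of $R$: $S$ is (left) dense in $T$ if for each $t\in T$ there is $r\in R$ with $rt\in S$. For a right $R$-module $M$ put ${}'\mathcal C_M=\{a\in R: m\mapsto ma \text{ is injective on } M\}$; in particular ${}'\mathcal C_R$ is the set of left regular elements of $R$. Let ${}'S(R)$ be the largest left denominator set of $R$ contained in ${}'\mathcal C_R$ and ${}'Q(R)={}'S(R)^{-1}R$. When ${}'\mathcal C_R$ is itself a left denominator set, put ${}'Q_{l,cl}(R)={}'\mathcal C_R^{-1}R$; otherwise ${}'Q_{l,cl}(R)$ does not exist. Let ${}'\Delta_n=\Delta_n\cap{}'S(\mathbb I_n)$. Let $P_n'=K[\partial_1,\dots,\partial_n]$ be the right $\mathbb I_n$-module in which $p\cdot\partial_i=p\,\partial_i$, $p\cdot x_i=\partial p/\partial(\partial_i)$, and $\partial^\alpha\cdot\int_i=\partial^{\alpha-e_i}$ if $\alpha_i>0$, $\partial^\alpha\cdot\int_i=0$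 if $\alpha_i=0$. **Theorem.** The set of regular elements of $A_n$ is a left denominator set of $A_n$; let $Q(A_n)$ be the corresponding quotient ring. The module $P_n'$ is the unique (up to isomorphism) simple faithful right $\mathbb I_n$-module. The following statements are equivalent: 1. ${}'Q(\mathbb I_n)\simeq Q(A_n)$ (as rings, or, equivalently, as $K$-algebras). 2. ${}'Q_{l,cl}(\mathbb I_n)$ exists and ${}'Q_{l,cl}(\mathbb I_n)\simeq Q(A_n)$ (as rings, or, equivalently, as $K$-algebras). 3. The image $\overline{{}'S(\mathbb I_n)}$ is dense in $B_n\setminus\{0\}$. 4. The image $\overline{{}'\mathcal C_{\mathbb I_n}}$ is dense in $B_n\setminus\{0\}$. 5. The image of ${}'\Delta_n$ is dense in $B_n\setminus\{0\}$. 6. ${}'\Delta_n$ is left dense in $\Delta_n\setminus\{0\}$ (as multiplicative sets of the ring $\Delta_n$). 7. For each $s\in\Delta_n\setminus\{0\}$ there is $s'\in\Delta_n\setminus\{0\}$ such that $s's\in{}'\mathcal C_{F_n}$. 8. For each $s\in\Delta_n\setminus\{0\}$ there is $s'\in\Delta_n\setminus\{0\}$ such that $s's\in{}'\mathcal C_{P_n'}$.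 -/

import Mathlib

/-! ### Left denominator sets and left quotient rings -/

section Localization

variable {R : Type*} [Ring R]

/-- A left denominator set of a ring `R`: a multiplicative set `S` (so `1 ∈ S`, `S S ⊆ S` and
`0 ∉ S`) such that `S r ∩ R s ≠ ∅` for all `r ∈ R`, `s ∈ S` and such that `r s = 0` with `s ∈ S`
implies `t r = 0` for some `t ∈ S`. -/
structure IsLeftDenominator (S : Submonoid R) : Prop where
  zero_notMem : (0 : R) ∉ S
  ore : ∀ r : R, ∀ s ∈ S, ∃ s' ∈ S, ∃ r' : R, s' * r = r' * s
  reversible : ∀ r : R, ∀ s ∈ S, r * s = 0 → ∃ t ∈ S, t * r = 0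

theorem IsLeftDenominator.nonempty_oreSet {S : Submonoid R} (h : IsLeftDenominator S) :
    Nonempty (OreLocalization.OreSet S) := by
  rw [OreLocalization.nonempty_oreSet_iff]
  refine ⟨fun r₁ r₂ s hs => ?_, fun r s => ?_⟩
  · obtain ⟨t, ht, h0⟩ := h.reversible (r₁ - r₂) s s.2 (by rw [sub_mul, hs, sub_self])
    exact ⟨⟨t, ht⟩, by rwa [mul_sub, sub_eq_zero] at h0⟩
  · obtain ⟨s', hs', r', e⟩ := h.ore r s s.2
    exact ⟨r', ⟨s', hs'⟩, e⟩

/-- The left quotient ring `S⁻¹ R` of `R` at a left denominator set `S`. -/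
def LeftQuotient (S : Submonoid R) (h : IsLeftDenominator S) : Type _ :=
  letI := Classical.choice h.nonempty_oreSet
  OreLocalization S R

noncomputable instance LeftQuotient.instRing (S : Submonoid R) (h : IsLeftDenominator S) :
    Ring (LeftQuotient S h) :=
  @OreLocalization.instRing R _ S (Classical.choice h.nonempty_oreSet)

noncomputable instance LeftQuotient.instAlgebra (K : Type*) [CommRing K] [Algebra K R]
    (S : Submonoid R) (h : IsLeftDenominator S) : Algebra K (LeftQuotient S h) :=
  @OreLocalization.instAlgebra R _ S (Classical.choice h.nonempty_oreSet) K _ _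

variable (R) in
/-- The monoid `'C_R` of left regular elements of `R`, i.e. of the elements `c` such that
`x ↦ x c` is injective on `R`. -/
abbrev leftRegular : Submonoid R := nonZeroDivisorsRight R

variable (R) in
/-- The largest left denominator set `'S(R)` of `R` that is contained in `'C_R`, constructed as
the submonoid generated by all such sets; `isGreatest_leftRegDenominator` shows that it is
indeed the largest one. -/
def leftRegDenominator : Submonoid R :=
  sSup {S : Submonoid R | IsLeftDenominator S ∧ S ≤ leftRegular R}

theorem leftRegDenominator_le : leftRegDenominator R ≤ leftRegular R :=
  sSup_le fun _ hS => hS.2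

theorem isLeftDenominator_leftRegDenominator [Nontrivial R] :
    IsLeftDenominator (leftRegDenominator R) where
  zero_notMem h0 := one_ne_zero (leftRegDenominator_le h0 (1 : R) (mul_zero _))
  ore := by
    let T : Submonoid R :=
      { carrier := {s | ∀ r : R, ∃ s' ∈ leftRegDenominator R, ∃ r' : R, s' * r = r' * s}
        one_mem' := fun r => ⟨1, one_mem _, r, by simp⟩
        mul_mem' := by
          intro a b ha hb r
          obtain ⟨s₁, hs₁, r₁, e₁⟩ := hb r
          obtain ⟨s₂, hs₂, r₂, e₂⟩ := ha r₁
          exact ⟨s₂ * s₁, mul_mem hs₂ hs₁, r₂, by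
            rw [mul_assoc, e₁, ← mul_assoc, e₂, mul_assoc]⟩ }
    have hT : leftRegDenominator R ≤ T := by
      refine sSup_le fun S hS s hs r => ?_
      obtain ⟨s', hs', r', e⟩ := hS.1.ore r s hs
      exact ⟨s', le_sSup (show S ∈ {S : Submonoid R | _} from hS) hs', r', e⟩
    exact fun r s hs => hT hs r
  reversible r s hs h0 := ⟨1, one_mem _, by rw [leftRegDenominator_le hs r h0, mul_zero]⟩

theorem isGreatest_leftRegDenominator [Nontrivial R] :
    IsGreatest {S : Submonoid R | IsLeftDenominator S ∧ S ≤ leftRegular R}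
      (leftRegDenominator R) :=
  ⟨⟨isLeftDenominator_leftRegDenominator, leftRegDenominator_le⟩, fun _ hS => le_sSup hS⟩

/-- The left regular left quotient ring `'Q(R) = 'S(R)⁻¹ R` of a nonzero ring `R`. -/
abbrev LeftRegQuotient (R : Type*) [Ring R] [Nontrivial R] : Type _ :=
  LeftQuotient (leftRegDenominator R) isLeftDenominator_leftRegDenominator

/-- A multiplicative subset of `R`: it contains `1`, is closed under products and does not
contain `0`. -/
structure IsMultiplicativeSet {R : Type*} [Semiring R] (S : Set R) : Prop where
  one_mem : (1 : R) ∈ S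
  mul_mem : ∀ a ∈ S, ∀ b ∈ S, a * b ∈ S
  zero_notMem : (0 : R) ∉ S

/-- A multiplicative set `S` is (left) dense in a multiplicative set `T ⊇ S` of `R` if each
`t ∈ T` has a left multiple `r t ∈ S` with `r ∈ R`. -/
structure IsLeftDense {R : Type*} [Semiring R] (S T : Set R) : Prop where
  left : IsMultiplicativeSet S
  right : IsMultiplicativeSet T
  subset : S ⊆ T
  dense : ∀ t ∈ T, ∃ r : R, r * t ∈ S

/-- The set `'C_M` of a right `R`-module `M`: all `a ∈ R` such that `m ↦ m a` is injective. -/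
def leftRegularOn (R : Type*) [Ring R] (M : Type*) [AddCommGroup M] [Module Rᵐᵒᵖ M] : Set R :=
  {a | ∀ m : M, MulOpposite.op a • m = 0 → m = 0}

end Localization

/-! ### The Weyl algebra and the algebra of polynomial integro-differential operators -/

section IntegroDifferential

open MvPolynomial

variable (K : Type*) [Field K] (n : ℕ)

/-- Multiplication by the variable `x_i` on `P_n = K[x_1, …, x_n]`. -/
noncomputable def opX (i : Fin n) : Module.End K (MvPolynomial (Fin n) K) :=
  LinearMap.mulLeft K (X i)

/-- The partial derivative `∂_i` on `P_n`. -/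
noncomputable def opD (i : Fin n) : Module.End K (MvPolynomial (Fin n) K) :=
  (pderiv i).toLinearMap

/-- The integration `∫_i` on `P_n`: `x^α ↦ (α_i + 1)⁻¹ x_i x^α`. -/
noncomputable def opI (i : Fin n) : Module.End K (MvPolynomial (Fin n) K) :=
  (basisMonomials (Fin n) K).constr K
    fun α => monomial (α + Finsupp.single i 1) ((α i + 1 : K)⁻¹)

/-- The Weyl algebra `A_n`, as an algebra of differential operators on `P_n`. -/
noncomputable def weylAlg : Subalgebra K (Module.End K (MvPolynomial (Fin n) K)) :=
  Algebra.adjoin K (Set.range (opX K n) ∪ Set.range (opD K n))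

/-- The algebra `𝕀_n` of polynomial integro-differential operators. -/
noncomputable def intDiffAlg : Subalgebra K (Module.End K (MvPolynomial (Fin n) K)) :=
  Algebra.adjoin K (Set.range (opX K n) ∪ Set.range (opD K n) ∪ Set.range (opI K n))

/-- `x_i` as an element of `𝕀_n`. -/
noncomputable def elX (i : Fin n) : intDiffAlg K n :=
  ⟨opX K n i, Algebra.subset_adjoin (Or.inl (Or.inl ⟨i, rfl⟩))⟩

/-- `∂_i` as an element of `𝕀_n`. -/
noncomputable def elD (i : Fin n) : intDiffAlg K n :=
  ⟨opD K n i, Algebra.subset_adjoin (Or.inl (Or.inr ⟨i, rfl⟩))⟩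

/-- `∫_i` as an element of `𝕀_n`. -/
noncomputable def elI (i : Fin n) : intDiffAlg K n :=
  ⟨opI K n i, Algebra.subset_adjoin (Or.inr ⟨i, rfl⟩)⟩

/-- `H_i = ∂_i x_i` as an element of `𝕀_n`. -/
noncomputable def elH (i : Fin n) : intDiffAlg K n := elD K n i * elX K n i

/-- The matrix unit `e_{st}(i) = ∫_i^s ∂_i^t - ∫_i^{s+1} ∂_i^{t+1}`. -/
noncomputable def elE (i : Fin n) (s t : ℕ) : intDiffAlg K n :=
  elI K n i ^ s * elD K n i ^ t - elI K n i ^ (s + 1) * elD K n i ^ (t + 1)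

/-- The matrix unit `e_{αβ} = ∏_i e_{α_i β_i}(i)` (the factors commute). -/
noncomputable def elEE (α β : Fin n → ℕ) : intDiffAlg K n :=
  (List.ofFn fun i => elE K n i (α i) (β i)).prod

/-- `F_n = F(1) ⊗ ⋯ ⊗ F(n) = ⨁ K e_{αβ}`, the smallest nonzero ideal of `𝕀_n`. -/
noncomputable def idealF : Submodule K (intDiffAlg K n) :=
  Submodule.span K {e | ∃ α β : Fin n → ℕ, e = elEE K n α β}

/-- The ideal `𝔭_i = 𝕀_1 ⊗ ⋯ ⊗ F(i) ⊗ ⋯ ⊗ 𝕀_1` of `𝕀_n`, i.e. the ideal generated by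
`F(i) = ⨁ K e_{st}(i)`. -/
noncomputable def idealP (i : Fin n) : TwoSidedIdeal (intDiffAlg K n) :=
  TwoSidedIdeal.span {e | ∃ s t : ℕ, e = elE K n i s t}

/-- The ideal `𝔞_n = 𝔭_1 + ⋯ + 𝔭_n` of `𝕀_n`. -/
noncomputable def idealA : TwoSidedIdeal (intDiffAlg K n) := ⨆ i, idealP K n i

/-- The factor algebra `B_n = 𝕀_n / 𝔞_n`. -/
abbrev algB : Type _ := (idealA K n).ringCon.Quotient

/-- The canonical epimorphism `𝕀_n → B_n`. -/
noncomputable def toB : intDiffAlg K n →+* algB K n := (idealA K n).ringCon.mk'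

/-- The algebra `Δ_n = K[H_1, …, H_n][∂_1, …, ∂_n; τ_1, …, τ_n]`, `τ_i(H_i) = H_i + 1`,
as the subalgebra of `𝕀_n` generated by the `H_i` and the `∂_i`. -/
noncomputable def algDelta : Subalgebra K (intDiffAlg K n) :=
  Algebra.adjoin K (Set.range (elH K n) ∪ Set.range (elD K n))

/-- The set `'Δ_n = Δ_n ∩ 'S(𝕀_n)`. -/
def leftDelta : Set (intDiffAlg K n) :=
  (algDelta K n : Set (intDiffAlg K n)) ∩ (leftRegDenominator (intDiffAlg K n))

/-- The set `'C_{F_n}` of all `a ∈ 𝕀_n` such that `f ↦ f a` is injective on `F_n`. -/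
def leftRegularF : Set (intDiffAlg K n) :=
  {a | ∀ f ∈ idealF K n, f * a = 0 → f = 0}

end IntegroDifferential

/-! ### The right `𝕀_n`-module `P'_n = K[∂_1, …, ∂_n]` -/

section RightModule

open MvPolynomial

variable {K : Type*} [Field K] {n : ℕ}

/-- The pairing `(p, f) ↦ (p(∂) f)(0)` between `K[∂_1, …, ∂_n]` and `K[x_1, …, x_n]`,
in coordinates `⟨∂^α, x^β⟩ = δ_{αβ} α!`. -/
noncomputable def diffPairing :
    MvPolynomial (Fin n) K →ₗ[K] MvPolynomial (Fin n) K →ₗ[K] K :=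
  (basisMonomials (Fin n) K).constr K fun α =>
    ((∏ i, (α i).factorial : ℕ) : K) • lcoeff K α

theorem diffPairing_monomial (α : Fin n →₀ ℕ) (a : K) (f : MvPolynomial (Fin n) K) :
    diffPairing (monomial α a) f = ((∏ i, (α i).factorial : ℕ) : K) * (a * coeff α f) := by
  have h : (monomial α a : MvPolynomial (Fin n) K) = a • basisMonomials (Fin n) K α := by
    simp [smul_monomial]
  rw [h, map_smul, diffPairing, Module.Basis.constr_basis]
  simp only [LinearMap.smul_apply, lcoeff_apply, smul_eq_mul]
  ring

theorem diffPairing_apply_monomial (p : MvPolynomial (Fin n) K) (β : Fin n →₀ ℕ) (b : K) :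
    diffPairing p (monomial β b) = ((∏ i, (β i).factorial : ℕ) : K) * (coeff β p * b) := by
  induction p using MvPolynomial.induction_on' with
  | monomial u a =>
    rw [diffPairing_monomial, coeff_monomial, coeff_monomial]
    by_cases h : u = β
    · subst h; simp
    · simp [h, Ne.symm h]
  | add p q hp hq => rw [map_add, LinearMap.add_apply, hp, hq, coeff_add]; ring

theorem eq_of_diffPairing_eq [CharZero K] {p q : MvPolynomial (Fin n) K}
    (h : ∀ f, diffPairing p f = diffPairing q f) : p = q := by
  ext β
  have := h (monomial β 1)
  rw [diffPairing_apply_monomial, diffPairing_apply_monomial, mul_one, mul_one] at this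
  refine mul_left_cancel₀ ?_ this
  exact Nat.cast_ne_zero.2 (Finset.prod_ne_zero_iff.2 fun i _ => Nat.factorial_ne_zero _)

/-- The map `∂^α ↦ ∂^(α - e_i)` (`0` if `α_i = 0`) on `K[∂_1, …, ∂_n]`. -/
noncomputable def divD (i : Fin n) : Module.End K (MvPolynomial (Fin n) K) :=
  (basisMonomials (Fin n) K).constr K
    fun α => if α i = 0 then 0 else monomial (α - Finsupp.single i 1) 1

theorem divD_monomial (i : Fin n) (α : Fin n →₀ ℕ) (a : K) :
    divD i (monomial α a) = if α i = 0 then 0 else monomial (α - Finsupp.single i 1) a := by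
  have h : (monomial α a : MvPolynomial (Fin n) K) = a • basisMonomials (Fin n) K α := by
    simp [smul_monomial]
  rw [h, map_smul, divD, Module.Basis.constr_basis]
  split_ifs <;> simp [smul_monomial]

theorem opI_monomial (i : Fin n) (α : Fin n →₀ ℕ) (a : K) :
    opI K n i (monomial α a) = monomial (α + Finsupp.single i 1) ((α i + 1 : K)⁻¹ * a) := by
  have h : (monomial α a : MvPolynomial (Fin n) K) = a • basisMonomials (Fin n) K α := by
    simp [smul_monomial]
  rw [h, map_smul, opI, Module.Basis.constr_basis, smul_monomial, smul_eq_mul, mul_comm]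

theorem prod_factorial_add_single (β : Fin n →₀ ℕ) (i : Fin n) :
    ∏ j, ((β + Finsupp.single i 1 : Fin n →₀ ℕ) j).factorial =
      (β i + 1) * ∏ j, (β j).factorial := by
  rw [← Finset.mul_prod_erase _ _ (Finset.mem_univ i),
    ← Finset.mul_prod_erase Finset.univ (fun j => (β j).factorial) (Finset.mem_univ i)]
  have : ∏ j ∈ Finset.univ.erase i, ((β + Finsupp.single i 1 : Fin n →₀ ℕ) j).factorial =
      ∏ j ∈ Finset.univ.erase i, (β j).factorial := by
    refine Finset.prod_congr rfl fun j hj => ?_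
    rw [Finsupp.add_apply, Finsupp.single_eq_of_ne (Finset.ne_of_mem_erase hj), add_zero]
  rw [this, Finsupp.add_apply, Finsupp.single_eq_same, Nat.factorial_succ, mul_assoc]

/-- `b` is adjoint to `a` for the pairing. -/
def IsAdj (a b : Module.End K (MvPolynomial (Fin n) K)) : Prop :=
  ∀ p f, diffPairing (b p) f = diffPairing p (a f)

theorem isAdj_of_monomial {a b : Module.End K (MvPolynomial (Fin n) K)}
    (h : ∀ p β, diffPairing (b p) (monomial β 1) = diffPairing p (a (monomial β 1))) :
    IsAdj a b := by
  intro p f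
  induction f using MvPolynomial.induction_on' with
  | monomial u c =>
    have e : (monomial u c : MvPolynomial (Fin n) K) = c • monomial u 1 := by
      simp [smul_monomial]
    rw [e, map_smul, map_smul, map_smul, h]
  | add f g hf hg => rw [map_add, map_add, map_add, hf, hg]

theorem isAdj_opX (i : Fin n) :
    IsAdj (opX K n i) (pderiv i : Derivation K _ _).toLinearMap := by
  refine isAdj_of_monomial fun p β => ?_
  induction p using MvPolynomial.induction_on' with
  | monomial u a =>
    have e : opX K n i (monomial β 1) = monomial (β + Finsupp.single i 1) (1 : K) := by
      simp [opX, X, monomial_mul, add_comm]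
    rw [e, diffPairing_apply_monomial, diffPairing_apply_monomial, Derivation.coeFn_coe, pderiv_monomial, coeff_monomial, coeff_monomial,
      prod_factorial_add_single]
    by_cases h : u = β + Finsupp.single i 1
    · subst h
      simp
      ring
    · rw [if_neg h]
      by_cases h0 : u i = 0
      · simp [h0]
      · rw [if_neg]
        · simp
        · intro h'
          apply h
          rw [← h', tsub_add_cancel_of_le]
          rw [Finsupp.single_le_iff]
          omega
  | add p q hp hq => simp only [map_add, LinearMap.add_apply, hp, hq]

theorem isAdj_opD (i : Fin n) :
    IsAdj (opD K n i) (LinearMap.mulLeft K (X i)) := by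
  refine isAdj_of_monomial fun p β => ?_
  rw [diffPairing_apply_monomial, opD, Derivation.coeFn_coe, pderiv_monomial, diffPairing_apply_monomial, LinearMap.mulLeft_apply,
      coeff_X_mul']
  by_cases h0 : β i = 0
  · simp [h0]
  · obtain ⟨γ, rfl⟩ : ∃ γ, β = γ + Finsupp.single i 1 :=
      ⟨β - Finsupp.single i 1, by
        rw [tsub_add_cancel_of_le]; rw [Finsupp.single_le_iff]; omega⟩
    rw [if_pos (Finsupp.mem_support_iff.2 h0), prod_factorial_add_single]
    simp
    ring

theorem isAdj_opI [CharZero K] (i : Fin n) : IsAdj (opI K n i) (divD i) := by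
  refine isAdj_of_monomial fun p β => ?_
  induction p using MvPolynomial.induction_on' with
  | monomial u a =>
    rw [opI_monomial, divD_monomial, diffPairing_apply_monomial, diffPairing_apply_monomial,
      prod_factorial_add_single, coeff_monomial]
    have hβ : (β i + 1 : K) ≠ 0 := by exact_mod_cast Nat.succ_ne_zero (β i)
    by_cases h : u = β + Finsupp.single i 1
    · subst h
      simp
      field_simp
    · rw [if_neg h]
      by_cases h0 : u i = 0
      · simp [h0]
      · rw [if_neg h0, coeff_monomial, if_neg]
        · simp
        · intro h'
          apply h
          rw [← h', tsub_add_cancel_of_le]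
          rw [Finsupp.single_le_iff]
          omega
  | add p q hp hq => simp only [map_add, LinearMap.add_apply, hp, hq]

theorem exists_isAdj [CharZero K] (a : intDiffAlg K n) :
    ∃ b : Module.End K (MvPolynomial (Fin n) K), IsAdj (a : Module.End K _) b := by
  obtain ⟨a, ha⟩ := a
  change ∃ b, IsAdj a b
  unfold intDiffAlg at ha
  induction ha using Algebra.adjoin_induction with
  | mem x hx =>
    rcases hx with (⟨i, rfl⟩ | ⟨i, rfl⟩) | ⟨i, rfl⟩
    · exact ⟨_, isAdj_opX i⟩
    · exact ⟨_, isAdj_opD i⟩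
    · exact ⟨_, isAdj_opI i⟩
  | algebraMap r => exact ⟨r • 1, fun p f => by simp [Module.algebraMap_end_apply]⟩
  | add x y _ _ hx hy =>
    obtain ⟨b, hb⟩ := hx
    obtain ⟨c, hc⟩ := hy
    exact ⟨b + c, fun p f => by simp [hb p f, hc p f]⟩
  | mul x y _ _ hx hy =>
    obtain ⟨b, hb⟩ := hx
    obtain ⟨c, hc⟩ := hy
    exact ⟨c * b, fun p f => by simp [hb p _, hc _ f]⟩

/-- The polynomial algebra `P'_n = K[∂_1, …, ∂_n]`, as the carrier of a right `𝕀_n`-module. -/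
def RightP (K : Type*) [Field K] (n : ℕ) : Type _ := MvPolynomial (Fin n) K

noncomputable instance RightP.instAddCommGroup : AddCommGroup (RightP K n) :=
  inferInstanceAs (AddCommGroup (MvPolynomial (Fin n) K))

/-- The right action `p ↦ p a` of `a ∈ 𝕀_n` on `K[∂_1, …, ∂_n]`: `p a` is the polynomial with
`((p a)(∂) f)(0) = (p(∂) (a f))(0)` for all `f ∈ P_n`. On generators it is given by
`p ∂_i = ∂_i p`, `p x_i = ∂p/∂(∂_i)` and `∂^α ∫_i = ∂^(α - e_i)` (`0` if `α_i = 0`), see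
`rightAct_elD`, `rightAct_elX` and `rightAct_elI`. -/
noncomputable def rightAct [CharZero K] (a : intDiffAlg K n) :
    Module.End K (MvPolynomial (Fin n) K) :=
  Classical.choose (exists_isAdj a)

theorem rightAct_spec [CharZero K] (a : intDiffAlg K n) (p f : MvPolynomial (Fin n) K) :
    diffPairing (rightAct a p) f = diffPairing p ((a : Module.End K _) f) :=
  Classical.choose_spec (exists_isAdj a) p f

theorem rightAct_eq [CharZero K] {a : intDiffAlg K n} {b : Module.End K (MvPolynomial (Fin n) K)}
    (h : IsAdj (a : Module.End K _) b) : rightAct a = b :=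
  LinearMap.ext fun p => eq_of_diffPairing_eq fun f => by rw [rightAct_spec, h p f]

theorem rightAct_elX [CharZero K] (i : Fin n) (p : MvPolynomial (Fin n) K) :
    rightAct (elX K n i) p = pderiv i p :=
  LinearMap.congr_fun (rightAct_eq (isAdj_opX i)) p

theorem rightAct_elD [CharZero K] (i : Fin n) (p : MvPolynomial (Fin n) K) :
    rightAct (elD K n i) p = X i * p :=
  LinearMap.congr_fun (rightAct_eq (a := elD K n i) (isAdj_opD i)) p

theorem rightAct_elI [CharZero K] (i : Fin n) (α : Fin n →₀ ℕ) :
    rightAct (elI K n i) (monomial α 1) =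
      if α i = 0 then 0 else monomial (α - Finsupp.single i 1) 1 := by
  rw [rightAct_eq (isAdj_opI i), divD_monomial]

theorem rightAct_one [CharZero K] : rightAct (1 : intDiffAlg K n) = 1 :=
  rightAct_eq fun _ _ => rfl

theorem rightAct_zero [CharZero K] : rightAct (0 : intDiffAlg K n) = 0 :=
  rightAct_eq fun p f => by simp

theorem rightAct_add [CharZero K] (a b : intDiffAlg K n) :
    rightAct (a + b) = rightAct a + rightAct b :=
  rightAct_eq fun p f => by simp [rightAct_spec]

theorem rightAct_mul [CharZero K] (a b : intDiffAlg K n) :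
    rightAct (a * b) = rightAct b * rightAct a :=
  rightAct_eq fun p f => by simp [rightAct_spec]

/-- `P'_n = K[∂_1, …, ∂_n]` as a right `𝕀_n`-module. -/
noncomputable instance RightP.instModule [CharZero K] :
    Module (intDiffAlg K n)ᵐᵒᵖ (RightP K n) where
  smul a p := rightAct a.unop p
  one_smul p := LinearMap.congr_fun rightAct_one p
  mul_smul a b p := LinearMap.congr_fun (rightAct_mul b.unop a.unop) p
  smul_zero a := map_zero (rightAct a.unop)
  smul_add a p q := map_add (rightAct a.unop) p q
  add_smul a b p := LinearMap.congr_fun (rightAct_add a.unop b.unop) p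
  zero_smul p := LinearMap.congr_fun rightAct_zero p

end RightModule

/-!
The algebra `𝕀_n` acts faithfully from the right on `K[∂_1, …, ∂_n]`: `∂_i` multiplies by `∂_i`,
`H_i - 1` multiplies `∂^u` by `u_i`, and `e_{αβ}` is the matrix unit `∂^α ↦ ∂^β`. The matrix units
show at once that this module is simple. For any faithful module `M` some `m e_{00}` is nonzero, and
then `p ↦ m (∑ p_β e_{0β})` is a nonzero map from `K[∂_1, …, ∂_n]` to `M`, which is bijective if `M`
is simple (`nonempty_equiv_rightP`). The rows `∑ p_β e_{0β}` embed the module into `F_n`, which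
together with faithfulness gives `'C_{𝕀_n} = 'C_{F_n} = 'C_{P'_n}` (`mem_leftRegular_tfae`).

The elements of `Δ_n` act by `∂^u ↦ ∑ p_β(u) ∂^{u + β}` with polynomials `p_β`. Therefore `Δ_n` is a
domain (`algDelta_eq_zero_or_eq_zero`), and as it has polynomial growth, it satisfies the left Ore
condition (`algDelta_ore`). Let `δ = ∂_1 ⋯ ∂_n`. It is a normal element of `Δ_n`, has a right inverse
in `𝕀_n`, and for each `a ∈ 𝕀_n` some `δ^k a` lies in `Δ_n`. The ideal `𝔞_n` consists of the elements
killed by a power of `δ` (`toB_eq_zero_iff`), so that `B_n` is `Δ_n` with `δ` inverted. The Weyl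
algebra lies between `Δ_n` and `B_n`; hence it is a left Ore domain with the same quotient division
ring.

All equivalences follow from this picture, which `IsLeftOreFrame` states for an abstract ring `R`. The
powers of `δ` belong to `'S(R)`, so `'Q(R)` is a localization of the domain `R / 𝔞` inside its
quotient division ring `Q`. It is all of `Q` if and only if it is a division ring, and this happens
if and only if every element outside `𝔞` has a left multiple in `'S(R)`. Multiplying by powers of `δ`
moves such multiples into `Δ_n`. Finally, if every element outside `𝔞` has a left multiple in
`'C_R`, then the Ore condition of `Δ_n` shows that `'C_R` is a left denominator set, and therefore
`'C_R = 'S(R)` (`IsLeftOreFrame.tfae`).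
-/

/-! ### The right action of `𝕀_n` on `K[∂_1, …, ∂_n]` -/

section Action

open MvPolynomial

variable {K : Type*} [Field K] {n : ℕ}

/-- `∂^β`, as an ordered product. -/
noncomputable def elDD (K : Type*) [Field K] {n : ℕ} (β : Fin n →₀ ℕ) : intDiffAlg K n :=
  (List.ofFn fun i => elD K n i ^ β i).prod

/-- The monomial `∏ (H_i - 1)^{α_i}`, as an ordered product. Since `∂^u (H_i - 1) = u_i ∂^u`, it
maps `∂^u` to `u^α ∂^u`. -/
noncomputable def elHH (K : Type*) [Field K] {n : ℕ} (α : Fin n →₀ ℕ) : intDiffAlg K n :=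
  (List.ofFn fun i => (elH K n i - 1) ^ α i).prod

/-- The element `∑ p_β e_{0β}` of `F_n`, whose row number `0` is `p`. By `elRow_mul` the map
`p ↦ elRow p` embeds `P'_n` into `F_n` as a right module. -/
noncomputable def elRow (p : MvPolynomial (Fin n) K) : intDiffAlg K n :=
  ∑ β ∈ p.support, coeff β p • elEE K n 0 β

theorem elRow_mem_idealF (p : MvPolynomial (Fin n) K) : elRow p ∈ idealF K n := by
  rw [elRow]
  exact Submodule.sum_mem _ fun β _ => Submodule.smul_mem _ _ (Submodule.subset_span ⟨0, β, rfl⟩)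

variable [CharZero K]

/-- The action is faithful: an operator on `P_n` whose adjoint is `0` vanishes, as the coefficients of a
polynomial are its pairings with the monomials, up to factorials. -/
theorem rightAct_injective {a : intDiffAlg K n} (h : rightAct a = 0) : a = 0 := by
  refine Subtype.ext (LinearMap.ext fun f => ?_)
  ext β
  have := rightAct_spec a (monomial β 1) f
  rw [h, LinearMap.zero_apply, map_zero, LinearMap.zero_apply, diffPairing_monomial, one_mul] at this
  have h0 : ((∏ i, (β i).factorial : ℕ) : K) ≠ 0 :=
    Nat.cast_ne_zero.2 (Finset.prod_ne_zero_iff.2 fun i _ => Nat.factorial_ne_zero _)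
  simpa using (mul_eq_zero.1 this.symm).resolve_left h0

theorem rightAct_smul (c : K) (a : intDiffAlg K n) : rightAct (c • a) = c • rightAct a :=
  rightAct_eq fun p f => by simp [rightAct_spec]

theorem rightAct_sub (a b : intDiffAlg K n) : rightAct (a - b) = rightAct a - rightAct b :=
  rightAct_eq fun p f => by simp [rightAct_spec]

theorem rightAct_mul_apply (a b : intDiffAlg K n) (p : MvPolynomial (Fin n) K) :
    rightAct (a * b) p = rightAct b (rightAct a p) :=
  LinearMap.congr_fun (rightAct_mul a b) p

/-- By faithfulness an element of `𝕀_n` is determined by its values on the monomials `∂^u`; all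
identities in `𝕀_n` below are verified in this way. -/
theorem ext_rightAct {a b : intDiffAlg K n}
    (h : ∀ u, rightAct a (monomial u 1) = rightAct b (monomial u 1)) : a = b := by
  rw [← sub_eq_zero]
  refine rightAct_injective ((basisMonomials (Fin n) K).ext fun u => ?_)
  simp [rightAct_sub, h]

theorem rightAct_elD_monomial (i : Fin n) (u : Fin n →₀ ℕ) (c : K) :
    rightAct (elD K n i) (monomial u c) = monomial (u + Finsupp.single i 1) c := by
  rw [rightAct_elD, X, monomial_mul, one_mul, add_comm]

theorem rightAct_elX_monomial (i : Fin n) (u : Fin n →₀ ℕ) (c : K) :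
    rightAct (elX K n i) (monomial u c) = monomial (u - Finsupp.single i 1) (c * u i) := by
  rw [rightAct_elX, pderiv_monomial]

theorem rightAct_elI_monomial (i : Fin n) (u : Fin n →₀ ℕ) (c : K) :
    rightAct (elI K n i) (monomial u c) =
      if u i = 0 then 0 else monomial (u - Finsupp.single i 1) c := by
  rw [rightAct_eq (isAdj_opI i), divD_monomial]

theorem rightAct_elH_monomial (i : Fin n) (u : Fin n →₀ ℕ) (c : K) :
    rightAct (elH K n i) (monomial u c) = monomial u (c * (u i + 1)) := by
  rw [elH, rightAct_mul_apply, rightAct_elD_monomial, rightAct_elX_monomial]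
  simp

theorem rightAct_elD_pow_monomial (i : Fin n) (t : ℕ) (u : Fin n →₀ ℕ) (c : K) :
    rightAct (elD K n i ^ t) (monomial u c) = monomial (u + Finsupp.single i t) c := by
  induction t with
  | zero => simp [rightAct_one]
  | succ t ih =>
    rw [pow_succ, rightAct_mul_apply, ih, rightAct_elD_monomial, add_assoc, ← Finsupp.single_add]

theorem rightAct_elI_pow_monomial (i : Fin n) (s : ℕ) (u : Fin n →₀ ℕ) (c : K) :
    rightAct (elI K n i ^ s) (monomial u c) =
      if s ≤ u i then monomial (u - Finsupp.single i s) c else 0 := by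
  induction s with
  | zero => simp [rightAct_one]
  | succ s ih =>
    rw [pow_succ, rightAct_mul_apply, ih]
    split_ifs with h1 h2 h2
    · rw [rightAct_elI_monomial, if_neg (by simp; omega), tsub_tsub, ← Finsupp.single_add]
    · rw [rightAct_elI_monomial, if_pos (by simp; omega)]
    · omega
    · simp

theorem rightAct_elE_monomial (i : Fin n) (s t : ℕ) (u : Fin n →₀ ℕ) (c : K) :
    rightAct (elE K n i s t) (monomial u c) =
      if u i = s then monomial (u.update i t) c else 0 := by
  have e : ∀ s t, rightAct (elI K n i ^ s * elD K n i ^ t) (monomial u c) =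
      if s ≤ u i then monomial (u - Finsupp.single i s + Finsupp.single i t) c else 0 := by
    intro s t
    rw [rightAct_mul_apply, rightAct_elI_pow_monomial]
    split_ifs
    · rw [rightAct_elD_pow_monomial]
    · simp
  rw [elE, rightAct_sub, LinearMap.sub_apply, e, e]
  rcases lt_trichotomy (u i) s with h | h | h
  · rw [if_neg (by omega), if_neg (by omega), if_neg (by omega), sub_zero]
  · rw [if_pos (by omega), if_neg (by omega), if_pos h, sub_zero]
    refine congrArg (monomial · c) (Finsupp.ext fun j => ?_)
    by_cases hj : j = i
    · subst hj; simp [h]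
    · simp [Finsupp.single_eq_of_ne hj, hj]
  · rw [if_pos (by omega), if_pos (by omega), if_neg (by omega), sub_eq_zero]
    refine congrArg (monomial · c) (Finsupp.ext fun j => ?_)
    by_cases hj : j = i
    · subst hj; simp; omega
    · simp [Finsupp.single_eq_of_ne hj]

/-- The matrix unit `e_{αβ}` maps `∂^α` to `∂^β` and kills all other monomials. -/
theorem rightAct_elEE_monomial (α β u : Fin n →₀ ℕ) (c : K) :
    rightAct (elEE K n α β) (monomial u c) = if u = α then monomial β c else 0 := by
  have key : ∀ (l : List (Fin n)), l.Nodup → ∀ u : Fin n →₀ ℕ,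
      rightAct ((l.map fun i => elE K n i (α i) (β i)).prod) (monomial u c) =
        if ∀ i ∈ l, u i = α i then
          monomial (Finsupp.equivFunOnFinite.symm fun j => if j ∈ l then β j else u j) c else 0 := by
    -- The factors already applied have replaced the exponents `u_i` by `β_i`, but only for indices
    -- outside the remaining list, which is why `u` varies in the induction.
    intro l
    induction l with
    | nil =>
      intro _ u
      simp only [List.map_nil, List.prod_nil, rightAct_one, Module.End.one_apply, List.not_mem_nil,
        false_imp_iff, implies_true, if_true, if_false]
      exact congrArg (monomial · c) (Finsupp.ext fun j => by simp)
    | cons i l ih =>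
      intro hl u
      rw [List.nodup_cons] at hl
      rw [List.map_cons, List.prod_cons, rightAct_mul_apply, rightAct_elE_monomial]
      by_cases hi : u i = α i
      · rw [if_pos hi, ih hl.2]
        have hiff : (∀ j ∈ l, (u.update i (β i)) j = α j) ↔ ∀ j ∈ i :: l, u j = α j := by
          simp only [List.mem_cons, forall_eq_or_imp, hi, true_and]
          refine forall₂_congr fun j hj => ?_
          have : j ≠ i := fun h => hl.1 (h ▸ hj)
          simp [this]
        simp only [hiff]
        refine if_congr Iff.rfl (congrArg (monomial · c) (Finsupp.ext fun j => ?_)) rfl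
        by_cases hj : j = i
        · subst hj; simp [hl.1]
        · simp [hj]
      · rw [if_neg hi, map_zero, if_neg]
        exact fun h => hi (h i (by simp))
  have hu : (∀ i ∈ List.finRange n, u i = α i) ↔ u = α := by simp [Finsupp.ext_iff]
  rw [elEE, List.ofFn_eq_map, key _ (List.nodup_finRange n), if_congr hu rfl rfl]
  exact if_congr Iff.rfl (congrArg (monomial · c) (Finsupp.ext fun j => by simp)) rfl

theorem rightAct_elEE (α β : Fin n →₀ ℕ) (p : MvPolynomial (Fin n) K) :
    rightAct (elEE K n α β) p = monomial β (coeff α p) := by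
  induction p using MvPolynomial.induction_on' with
  | monomial u a =>
    rw [rightAct_elEE_monomial, coeff_monomial]
    split_ifs <;> simp
  | add p q hp hq => simp [hp, hq]

theorem rightAct_elDD_monomial (β u : Fin n →₀ ℕ) (c : K) :
    rightAct (elDD K β) (monomial u c) = monomial (u + β) c := by
  have key : ∀ (l : List (Fin n)) (u : Fin n →₀ ℕ),
      rightAct ((l.map fun i => elD K n i ^ β i).prod) (monomial u c) =
        monomial (u + (l.map fun i => Finsupp.single i (β i)).sum) c := by
    intro l
    induction l with
    | nil => simp [rightAct_one]
    | cons i l ih =>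
      intro u
      simp only [List.map_cons, List.prod_cons, List.sum_cons, rightAct_mul_apply,
        rightAct_elD_pow_monomial, ih, add_assoc]
  rw [elDD, List.ofFn_eq_map, key, ← List.ofFn_eq_map, List.sum_ofFn, Finsupp.univ_sum_single]

theorem rightAct_elHH_monomial (α u : Fin n →₀ ℕ) (c : K) :
    rightAct (elHH K α) (monomial u c) = monomial u (c * ∏ i, (u i : K) ^ α i) := by
  have hp : ∀ (i : Fin n) (k : ℕ) (c : K), rightAct ((elH K n i - 1) ^ k) (monomial u c) =
      monomial u (c * (u i : K) ^ k) := by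
    intro i k
    induction k with
    | zero => simp [rightAct_one]
    | succ k ih =>
      intro c
      rw [pow_succ, rightAct_mul_apply, ih, rightAct_sub, LinearMap.sub_apply,
        rightAct_elH_monomial, rightAct_one, Module.End.one_apply, ← map_sub]
      congr 1
      ring
  have key : ∀ (l : List (Fin n)) (c : K),
      rightAct ((l.map fun i => (elH K n i - 1) ^ α i).prod) (monomial u c) =
        monomial u (c * (l.map fun i => (u i : K) ^ α i).prod) := by
    intro l
    induction l with
    | nil => simp [rightAct_one]
    | cons i l ih =>
      intro c
      simp only [List.map_cons, List.prod_cons, rightAct_mul_apply, hp, ih, mul_assoc]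
  rw [elHH, List.ofFn_eq_map, key, ← List.ofFn_eq_map, List.prod_ofFn]

/-! ### The module `K[∂_1, …, ∂_n]` -/

theorem mem_leftRegularOn_rightP {a : intDiffAlg K n} :
    a ∈ leftRegularOn (intDiffAlg K n) (RightP K n) ↔
      ∀ p : MvPolynomial (Fin n) K, rightAct a p = 0 → p = 0 := Iff.rfl

theorem rightAct_elRow (p q : MvPolynomial (Fin n) K) :
    rightAct (elRow p) q = coeff 0 q • p := by
  have h : ∀ s : Finset (Fin n →₀ ℕ), rightAct (∑ β ∈ s, coeff β p • elEE K n 0 β) q =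
      ∑ β ∈ s, monomial β (coeff β p * coeff 0 q) := by
    intro s
    induction s using Finset.induction_on with
    | empty => simp [rightAct_zero]
    | insert a s ha ih =>
      rw [Finset.sum_insert ha, Finset.sum_insert ha, rightAct_add, LinearMap.add_apply, ih,
        rightAct_smul, LinearMap.smul_apply]
      congr 1
      have := rightAct_elEE (K := K) 0 a q
      rw [Finsupp.coe_zero] at this
      rw [this, smul_monomial, smul_eq_mul]
  rw [elRow, h]
  conv_rhs => rw [← p.support_sum_monomial_coeff, Finset.smul_sum]
  exact Finset.sum_congr rfl fun β _ => by rw [smul_monomial, smul_eq_mul, mul_comm]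

theorem elRow_mul (p : MvPolynomial (Fin n) K) (a : intDiffAlg K n) :
    elRow p * a = elRow (rightAct a p) :=
  ext_rightAct fun u => by
    rw [rightAct_mul_apply, rightAct_elRow, rightAct_elRow, map_smul]

theorem elRow_add (p q : MvPolynomial (Fin n) K) : elRow (p + q) = elRow p + elRow q :=
  ext_rightAct fun u => by
    rw [rightAct_add, LinearMap.add_apply, rightAct_elRow, rightAct_elRow, rightAct_elRow, smul_add]

theorem elRow_zero : elRow (0 : MvPolynomial (Fin n) K) = 0 :=
  ext_rightAct fun u => by simp [rightAct_elRow, rightAct_zero]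

theorem elRow_injective {p : MvPolynomial (Fin n) K} (h : elRow p = 0) : p = 0 := by
  have := rightAct_elRow p 1
  simpa [h, rightAct_zero] using this.symm

/-- As a right module, `P'_n` embeds into `F_n` (as a row), and it is faithful; hence an element
that is left regular on one of `𝕀_n`, `F_n`, `P'_n` is left regular on the others. -/
theorem mem_leftRegular_tfae (a : intDiffAlg K n) :
    List.TFAE [a ∈ leftRegular (intDiffAlg K n), a ∈ leftRegularF K n,
      a ∈ leftRegularOn (intDiffAlg K n) (RightP K n)] := by
  tfae_have 1 → 2 := fun h f _ hf => h f hf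
  tfae_have 2 → 3 := fun h => mem_leftRegularOn_rightP.2 fun p hp =>
    elRow_injective (h _ (elRow_mem_idealF p) (by rw [elRow_mul, hp, elRow_zero]))
  tfae_have 3 → 1 := fun h x hx => by
    refine rightAct_injective (LinearMap.ext fun p => ?_)
    refine mem_leftRegularOn_rightP.1 h (rightAct x p) ?_
    rw [← rightAct_mul_apply, hx, rightAct_zero, LinearMap.zero_apply]
  tfae_finish

theorem isSimpleModule_rightP : IsSimpleModule (intDiffAlg K n)ᵐᵒᵖ (RightP K n) := by
  have key : ∀ p : MvPolynomial (Fin n) K, p ≠ 0 → ∀ q, ∃ a : intDiffAlg K n,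
      rightAct a p = q := by
    intro p hp q
    obtain ⟨α, hα⟩ := MvPolynomial.ne_zero_iff.1 hp
    -- `e_{α0}` turns `p` into its coefficient at `∂^α`, and `1` generates the module.
    refine ⟨(coeff α p)⁻¹ • elEE K n α (0 : Fin n →₀ ℕ) * elRow q, ?_⟩
    rw [rightAct_mul_apply, rightAct_smul, LinearMap.smul_apply, rightAct_elEE, rightAct_elRow]
    simp [hα]
  rw [isSimpleModule_iff_toSpanSingleton_surjective]
  refine ⟨inferInstanceAs (Nontrivial (MvPolynomial (Fin n) K)), fun p hp q => ?_⟩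
  obtain ⟨a, ha⟩ := key p hp q
  exact ⟨MulOpposite.op a, ha⟩

theorem faithfulSMul_rightP : FaithfulSMul (intDiffAlg K n)ᵐᵒᵖ (RightP K n) where
  eq_of_smul_eq_smul h := MulOpposite.unop_injective (ext_rightAct fun u =>
    h (monomial u 1 : MvPolynomial (Fin n) K))

/-- If `M` is faithful, then `m e_{00} ≠ 0` for some `m ∈ M`, and `p ↦ m (∑ p_β e_{0β})` is a
nonzero map `P'_n → M`. -/
theorem nonempty_equiv_rightP (M : Type*) [AddCommGroup M] [Module (intDiffAlg K n)ᵐᵒᵖ M]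
    (hs : IsSimpleModule (intDiffAlg K n)ᵐᵒᵖ M) (hf : FaithfulSMul (intDiffAlg K n)ᵐᵒᵖ M) :
    Nonempty (M ≃ₗ[(intDiffAlg K n)ᵐᵒᵖ] RightP K n) := by
  have := isSimpleModule_rightP (K := K) (n := n)
  obtain ⟨m, hm⟩ : ∃ m : M, MulOpposite.op (elRow (1 : MvPolynomial (Fin n) K)) • m ≠ 0 := by
    by_contra! h
    have h0 : MulOpposite.op (elRow (1 : MvPolynomial (Fin n) K)) = 0 :=
      hf.eq_of_smul_eq_smul fun m => by rw [h m, zero_smul]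
    exact one_ne_zero (elRow_injective ((MulOpposite.op_eq_zero_iff _).1 h0))
  let g : RightP K n →ₗ[(intDiffAlg K n)ᵐᵒᵖ] M :=
    { toFun := fun p => MulOpposite.op (elRow p) • m
      map_add' := fun p q => by
        rw [← add_smul, ← MulOpposite.op_add]
        exact congrArg (fun x => MulOpposite.op x • m) (elRow_add p q)
      map_smul' := fun a p => by
        rw [RingHom.id_apply, ← mul_smul]
        exact congrArg (fun x => MulOpposite.op x • m) (elRow_mul p a.unop).symm }
  have hg : g ≠ 0 := fun h => hm (LinearMap.congr_fun h (1 : MvPolynomial (Fin n) K))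
  have hb : Function.Bijective g :=
    LinearMap.bijective_of_ne_zero (R := (intDiffAlg K n)ᵐᵒᵖ) (M := RightP K n) (N := M) hg
  exact ⟨(LinearEquiv.ofBijective g hb).symm⟩

end Action

/-! ### Subexponential growth and the Ore condition -/

section Growth

open Filter in
theorem exists_pow_lt_two_pow (d k : ℕ) : ∃ j : ℕ, (j * d + 1) ^ k < 2 ^ j := by
  have hc : (0 : ℝ) < 1 / (2 * (d + 1) ^ k) := by positivity
  have h := (isLittleO_pow_const_const_pow_of_one_lt (R := ℝ) k (one_lt_two)).bound hc
  obtain ⟨j, hj, hj1⟩ := (h.and (eventually_ge_atTop 1)).exists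
  refine ⟨j, ?_⟩
  rw [Real.norm_of_nonneg (by positivity), Real.norm_of_nonneg (by positivity), div_mul_eq_mul_div,
    one_mul, le_div_iff₀ (by positivity)] at hj
  have h1 : ((j * d + 1 : ℕ) : ℝ) ^ k ≤ (j : ℝ) ^ k * (d + 1) ^ k := by
    rw [← mul_pow]
    refine pow_le_pow_left₀ (by positivity) ?_ k
    have : (1 : ℝ) ≤ j := by exact_mod_cast hj1
    push_cast
    linarith
  have h2 : (0 : ℝ) < 2 ^ j := by positivity
  have : ((j * d + 1 : ℕ) : ℝ) ^ k < 2 ^ j := by linarith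
  exact_mod_cast this

variable {K A : Type*} [Field K]

section Semiring

variable [Semiring A] [Algebra K A] {G : Submodule K A}

theorem pow_le_pow_of_one_mem (h1 : (1 : A) ∈ G) {m l : ℕ} (h : m ≤ l) : G ^ m ≤ G ^ l :=
  pow_le_pow_right₀ (Submodule.one_le.2 h1) h

theorem exists_mem_pow_of_mem_adjoin {s : Set A} {a : A} (h1 : (1 : A) ∈ G) (hs : s ⊆ G)
    (ha : a ∈ Algebra.adjoin K s) : ∃ m, a ∈ G ^ m := by
  induction ha using Algebra.adjoin_induction with
  | mem x hx => exact ⟨1, by rw [pow_one]; exact hs hx⟩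
  | algebraMap r => exact ⟨0, by rw [pow_zero]; exact Submodule.algebraMap_mem r⟩
  | add x y _ _ hx hy =>
    obtain ⟨m, hm⟩ := hx
    obtain ⟨l, hl⟩ := hy
    exact ⟨max m l, add_mem (pow_le_pow_of_one_mem h1 (le_max_left _ _) hm)
      (pow_le_pow_of_one_mem h1 (le_max_right _ _) hl)⟩
  | mul x y _ _ hx hy =>
    obtain ⟨m, hm⟩ := hx
    obtain ⟨l, hl⟩ := hy
    exact ⟨m + l, by rw [pow_add]; exact Submodule.mul_mem_mul hm hl⟩

theorem mem_adjoin_of_mem_pow {s : Set A} {a : A} {m : ℕ}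
    (ha : a ∈ Submodule.span K (insert 1 s) ^ m) : a ∈ Algebra.adjoin K s := by
  have h : Submodule.span K (insert 1 s) ≤ Subalgebra.toSubmodule (Algebra.adjoin K s) :=
    Submodule.span_le.2 (Set.insert_subset (Subalgebra.one_mem _) Algebra.subset_adjoin)
  induction m generalizing a with
  | zero =>
    rw [pow_zero, Submodule.mem_one] at ha
    obtain ⟨c, rfl⟩ := ha
    exact Subalgebra.algebraMap_mem _ c
  | succ m ih =>
    rw [pow_succ] at ha
    exact Submodule.mul_induction_on ha (fun x hx y hy => mul_mem (ih hx) (h hy))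
      fun x y hx hy => add_mem hx hy

end Semiring

variable [Ring A] [Algebra K A] {G : Submodule K A}

/-- A domain generated by a finite-dimensional space `G` is left Ore if the powers of `G` have
dimensions of polynomial growth: if `A r ∩ A s = 0`, then `(a, b) ↦ a r - b s` is injective, so that
the dimension doubles whenever the exponent is increased by the degree of `r` and `s`. The union of
the powers of `G` is the only part of `A` that matters. -/
theorem exists_mul_eq_mul_of_growth (h1 : (1 : A) ∈ G) (hG : G.FG) (k : ℕ)
    (hk : ∀ m, Module.finrank K (G ^ m : Submodule K A) ≤ (m + 1) ^ k)
    (hdom : ∀ a b : A, (∃ m, a ∈ G ^ m) → (∃ m, b ∈ G ^ m) → a * b = 0 → a = 0 ∨ b = 0)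
    {r s : A} (hr : ∃ m, r ∈ G ^ m) (hs : ∃ m, s ∈ G ^ m) (hs0 : s ≠ 0) :
    ∃ a b : A, (∃ m, a ∈ G ^ m) ∧ (∃ m, b ∈ G ^ m) ∧ a ≠ 0 ∧ a * r = b * s := by
  by_contra! H
  obtain ⟨d₁, hd₁⟩ := hr
  obtain ⟨d₂, hd₂⟩ := hs
  set d := max d₁ d₂
  replace hd₁ : r ∈ G ^ d := pow_le_pow_of_one_mem h1 (le_max_left _ _) hd₁
  replace hd₂ : s ∈ G ^ d := pow_le_pow_of_one_mem h1 (le_max_right _ _) hd₂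
  have hfin : ∀ m, Module.Finite K (G ^ m : Submodule K A) := fun m =>
    Module.Finite.iff_fg.2 (hG.pow m)
  have hinj : ∀ a b : A, (∃ m, a ∈ G ^ m) → (∃ m, b ∈ G ^ m) → a * r = b * s → a = 0 ∧ b = 0 := by
    intro a b ha hb h
    have ha0 : a = 0 := by
      by_contra ha0
      exact H a b ha hb ha0 h
    rw [ha0, zero_mul] at h
    exact ⟨ha0, (hdom b s hb ⟨d, hd₂⟩ h.symm).resolve_right hs0⟩
  have hstep : ∀ m, 2 * Module.finrank K (G ^ m : Submodule K A) ≤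
      Module.finrank K (G ^ (m + d) : Submodule K A) := by
    intro m
    let φ : ((G ^ m : Submodule K A) × (G ^ m : Submodule K A)) →ₗ[K]
        (G ^ (m + d) : Submodule K A) :=
      LinearMap.codRestrict _
        ((LinearMap.mulRight K r ∘ₗ (G ^ m).subtype ∘ₗ LinearMap.fst K _ _) -
          (LinearMap.mulRight K s ∘ₗ (G ^ m).subtype ∘ₗ LinearMap.snd K _ _))
        (fun x => by
          rw [pow_add]
          exact Submodule.sub_mem _ (Submodule.mul_mem_mul x.1.2 hd₁)
            (Submodule.mul_mem_mul x.2.2 hd₂))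
    have hφ : Function.Injective φ := by
      rw [injective_iff_map_eq_zero]
      intro x hx
      have hx' : (x.1 : A) * r - (x.2 : A) * s = 0 := congrArg Subtype.val hx
      obtain ⟨ha, hb⟩ := hinj x.1 x.2 ⟨m, x.1.2⟩ ⟨m, x.2.2⟩ (sub_eq_zero.1 hx')
      exact Prod.ext (Subtype.ext ha) (Subtype.ext hb)
    have := LinearMap.finrank_le_finrank_of_injective hφ
    rwa [Module.finrank_prod, ← two_mul] at this
  have hpow : ∀ j : ℕ, 2 ^ j ≤ Module.finrank K (G ^ (j * d) : Submodule K A) := by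
    intro j
    induction j with
    | zero =>
      rw [pow_zero, Nat.one_le_iff_ne_zero, zero_mul, Ne, Submodule.finrank_eq_zero, pow_zero]
      intro h0
      have : (1 : A) ∈ (1 : Submodule K A) := Submodule.one_le.1 le_rfl
      rw [h0, Submodule.mem_bot] at this
      exact hs0 (by rw [← one_mul s, this, zero_mul])
    | succ j ih =>
      rw [pow_succ, add_mul, one_mul]
      exact (by omega : 2 ^ j * 2 ≤ 2 * Module.finrank K (G ^ (j * d) : Submodule K A)).trans
        (hstep _)
  -- The dimension of `G ^ (j * d)` is at least `2 ^ j`, but polynomially bounded in `j`.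
  obtain ⟨j, hj⟩ := exists_pow_lt_two_pow d k
  exact absurd ((hpow j).trans (hk (j * d))) (not_le.2 hj)

end Growth

/-! ### The algebra `Δ_n` is a left Ore domain -/

section Delta

open MvPolynomial

variable {K : Type*} [Field K] {n : ℕ}

variable (K n) in
/-- The span of the monomials `(H - 1)^α ∂^β` all of whose exponents are at most `m`. -/
noncomputable def boxSpan (m : ℕ) : Submodule K (intDiffAlg K n) :=
  Submodule.span K {x | ∃ α β : Fin n →₀ ℕ, (∀ i, α i ≤ m) ∧ (∀ i, β i ≤ m) ∧
    x = elHH K α * elDD K β}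

variable (K n) in
/-- The set of generators of `Δ_n`. -/
def deltaGen : Set (intDiffAlg K n) := Set.range (elH K n) ∪ Set.range (elD K n)

theorem exists_mem_pow_of_mem_algDelta {d : intDiffAlg K n} (hd : d ∈ algDelta K n) :
    ∃ m, d ∈ Submodule.span K (insert 1 (deltaGen K n)) ^ m :=
  exists_mem_pow_of_mem_adjoin (K := K) (A := intDiffAlg K n) (s := deltaGen K n)
    (Submodule.subset_span (Set.mem_insert _ _))
    ((Set.subset_insert _ _).trans Submodule.subset_span) hd

theorem finrank_boxSpan_le (m : ℕ) : Module.finrank K (boxSpan K n m) ≤ (m + 1) ^ (2 * n) ∧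
    Module.Finite K (boxSpan K n m) := by
  let f : ((Fin n → Fin (m + 1)) × (Fin n → Fin (m + 1))) → intDiffAlg K n := fun q =>
    elHH K (Finsupp.equivFunOnFinite.symm fun i => (q.1 i : ℕ)) *
      elDD K (Finsupp.equivFunOnFinite.symm fun i => (q.2 i : ℕ))
  have h : boxSpan K n m = Submodule.span K (Set.range f) := by
    refine congrArg _ (Set.Subset.antisymm ?_ ?_)
    · rintro _ ⟨α, β, hα, hβ, rfl⟩
      refine ⟨(fun i => ⟨α i, Nat.lt_succ_of_le (hα i)⟩, fun i => ⟨β i, Nat.lt_succ_of_le (hβ i)⟩),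
        ?_⟩
      have e : ∀ γ : Fin n →₀ ℕ, Finsupp.equivFunOnFinite.symm (fun i => γ i) = γ :=
        fun γ => Finsupp.ext fun _ => rfl
      simp only [f, e]
    · rintro _ ⟨q, rfl⟩
      exact ⟨_, _, fun i => Nat.le_of_lt_succ (q.1 i).2, fun i => Nat.le_of_lt_succ (q.2 i).2, rfl⟩
  rw [h]
  refine ⟨(finrank_range_le_card f).trans ?_, Module.Finite.span_of_finite K (Set.finite_range f)⟩
  simp [two_mul, pow_add]

theorem prod_pow_add_single (u : Fin n → K) (α : Fin n →₀ ℕ) (i : Fin n) :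
    ∏ j, u j ^ (α + Finsupp.single i 1 : Fin n →₀ ℕ) j = (∏ j, u j ^ α j) * u i := by
  simp_rw [Finsupp.add_apply, pow_add, Finset.prod_mul_distrib]
  congr 1
  rw [Finset.prod_eq_single i]
  · simp
  · intro j _ hj; simp [Finsupp.single_eq_of_ne hj]
  · simp

/-- The action on `∂^u` of the element `∑ p_β(H - 1) ∂^β` of `Δ_n` with the coefficients `p`. -/
noncomputable def symbolAct (u : Fin n →₀ ℕ) :
    ((Fin n →₀ ℕ) →₀ MvPolynomial (Fin n) K) →ₗ[K] MvPolynomial (Fin n) K :=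
  Finsupp.lsum K fun β => monomial (u + β) ∘ₗ (aeval fun i => (u i : K)).toLinearMap

theorem symbolAct_apply (u : Fin n →₀ ℕ) (p : (Fin n →₀ ℕ) →₀ MvPolynomial (Fin n) K) :
    symbolAct u p = ∑ β ∈ p.support, monomial (u + β) (eval (fun i => (u i : K)) (p β)) := by
  rw [symbolAct, Finsupp.lsum_apply, Finsupp.sum]
  rfl

variable [CharZero K]

theorem rightAct_box_monomial (α β u : Fin n →₀ ℕ) (c : K) :
    rightAct (elHH K α * elDD K β) (monomial u c) =
      monomial (u + β) (c * ∏ i, (u i : K) ^ α i) := by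
  rw [rightAct_mul_apply, rightAct_elHH_monomial, rightAct_elDD_monomial]

/-- Appending a generator on the right, rather than on the left, keeps the monomials
`(H - 1)^α ∂^β` in order. -/
theorem box_mul_elD (α β : Fin n →₀ ℕ) (i : Fin n) :
    elHH K α * elDD K β * elD K n i = elHH K α * elDD K (β + Finsupp.single i 1) :=
  ext_rightAct fun u => by
    rw [rightAct_mul_apply, rightAct_box_monomial, rightAct_box_monomial, rightAct_elD_monomial,
      add_assoc]

theorem box_mul_elH (α β : Fin n →₀ ℕ) (i : Fin n) :
    elHH K α * elDD K β * elH K n i =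
      elHH K (α + Finsupp.single i 1) * elDD K β + (β i + 1 : K) • (elHH K α * elDD K β) :=
  ext_rightAct fun u => by
    rw [rightAct_mul_apply, rightAct_add, LinearMap.add_apply, rightAct_smul, LinearMap.smul_apply,
      rightAct_box_monomial, rightAct_box_monomial, rightAct_elH_monomial, smul_monomial,
      ← map_add, prod_pow_add_single]
    congr 1
    simp
    ring

theorem pow_span_deltaGen_le (m : ℕ) :
    Submodule.span K (insert 1 (deltaGen K n)) ^ m ≤ boxSpan K n m := by
  have hmono : ∀ m, boxSpan K n m ≤ boxSpan K n (m + 1) := fun m => Submodule.span_mono (by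
    rintro _ ⟨α, β, hα, hβ, rfl⟩
    exact ⟨α, β, fun i => (hα i).trans m.le_succ, fun i => (hβ i).trans m.le_succ, rfl⟩)
  have hstep : ∀ (γ : Fin n →₀ ℕ) (i : Fin n) (m : ℕ), (∀ j, γ j ≤ m) →
      ∀ j, (γ + Finsupp.single i 1 : Fin n →₀ ℕ) j ≤ m + 1 := by
    intro γ i m h j
    rw [Finsupp.add_apply]
    have : Finsupp.single i 1 j ≤ 1 := by
      rw [Finsupp.single_apply]; split_ifs <;> simp
    exact add_le_add (h j) this
  induction m with
  | zero =>
    rw [pow_zero, Submodule.one_le]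
    refine Submodule.subset_span ⟨0, 0, by simp, by simp, ext_rightAct fun u => ?_⟩
    simp [rightAct_box_monomial, rightAct_one]
  | succ m ih =>
    rw [pow_succ]
    refine (mul_le_mul' ih le_rfl).trans ?_
    rw [boxSpan, Submodule.span_mul_span, Submodule.span_le]
    rintro _ ⟨_, ⟨α, β, hα, hβ, rfl⟩, y, hy, rfl⟩
    have h0 : elHH K α * elDD K β ∈ boxSpan K n (m + 1) :=
      hmono m (Submodule.subset_span ⟨α, β, hα, hβ, rfl⟩)
    rcases hy with rfl | ⟨i, rfl⟩ | ⟨i, rfl⟩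
    · simpa using h0
    · change elHH K α * elDD K β * elH K n i ∈ boxSpan K n (m + 1)
      rw [box_mul_elH]
      exact add_mem (Submodule.subset_span
        ⟨_, β, hstep α i m hα, fun j => (hβ j).trans m.le_succ, rfl⟩) (Submodule.smul_mem _ _ h0)
    · change elHH K α * elDD K β * elD K n i ∈ boxSpan K n (m + 1)
      rw [box_mul_elD]
      exact Submodule.subset_span
        ⟨α, _, fun j => (hα j).trans m.le_succ, hstep β i m hβ, rfl⟩

/-- Every element of `Δ_n` has the form `∑ p_β(H - 1) ∂^β`. -/
theorem exists_symbol {d : intDiffAlg K n} (hd : d ∈ algDelta K n) :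
    ∃ p, ∀ u, rightAct d (monomial u 1) = symbolAct u p := by
  obtain ⟨m, hm⟩ := exists_mem_pow_of_mem_algDelta hd
  replace hm := pow_span_deltaGen_le m hm
  clear hd
  rw [boxSpan] at hm
  induction hm using Submodule.span_induction with
  | mem x hx =>
    obtain ⟨α, β, -, -, rfl⟩ := hx
    refine ⟨Finsupp.single β (monomial α 1), fun u => ?_⟩
    rw [rightAct_box_monomial, symbolAct, Finsupp.lsum_single]
    simp [eval_monomial, Finsupp.prod_fintype]
  | zero => exact ⟨0, fun u => by simp [rightAct_zero]⟩
  | add x y _ _ hx hy =>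
    obtain ⟨p, hp⟩ := hx
    obtain ⟨q, hq⟩ := hy
    exact ⟨p + q, fun u => by rw [rightAct_add, LinearMap.add_apply, hp, hq, map_add]⟩
  | smul c x _ hx =>
    obtain ⟨p, hp⟩ := hx
    exact ⟨c • p, fun u => by rw [rightAct_smul, LinearMap.smul_apply, hp, map_smul]⟩

theorem eq_zero_of_eval_natCast {p : MvPolynomial (Fin n) K}
    (h : ∀ u : Fin n →₀ ℕ, eval (fun i => (u i : K)) p = 0) : p = 0 := by
  refine MvPolynomial.funext_set (fun _ => Set.range ((↑) : ℕ → K))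
    (fun _ => Set.infinite_range_of_injective Nat.cast_injective) fun x hx => ?_
  choose u hu using fun i => hx i (Set.mem_univ i)
  rw [map_zero, ← h (Finsupp.equivFunOnFinite.symm u)]
  congr 2
  exact funext fun i => (hu i).symm

/-- The witness is the translated polynomial `p(x + β)`. -/
theorem exists_shift (β : Fin n →₀ ℕ) (p : MvPolynomial (Fin n) K) (hp : p ≠ 0) :
    ∃ q : MvPolynomial (Fin n) K, q ≠ 0 ∧ ∀ u : Fin n →₀ ℕ,
      eval (fun i => (u i : K)) q = eval (fun i => ((u + β : Fin n →₀ ℕ) i : K)) p := by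
  let q : (Fin n → K) → MvPolynomial (Fin n) K := fun v => aeval (fun i => X i + C (v i)) p
  have hq : ∀ v w : Fin n → K, eval w (q v) = eval (fun i => w i + v i) p := by
    intro v w
    change aeval (R := K) w (aeval _ p) = aeval _ p
    rw [comp_aeval_apply (φ := aeval (R := K) w)]
    simp
  refine ⟨q fun i => β i, fun h0 => hp ?_, fun u => ?_⟩
  · refine MvPolynomial.funext fun x => ?_
    have := hq (fun i => β i) (fun i => x i - β i)
    rw [h0] at this
    simpa using this.symm
  · rw [hq]
    congr 2
    funext i
    simp

/-- A product of nonzero elements with symbols `p`, `q` is nonzero: as `ℕ^n` has unique sums, some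
coefficient of the symbol of the product is a single product `p_β(u) q_γ(u + β)`. -/
theorem algDelta_eq_zero_or_eq_zero {a b : intDiffAlg K n} (ha : a ∈ algDelta K n)
    (hb : b ∈ algDelta K n) (hab : a * b = 0) : a = 0 ∨ b = 0 := by
  by_contra! h
  obtain ⟨p, hp⟩ := exists_symbol ha
  obtain ⟨q, hq⟩ := exists_symbol hb
  have hne : ∀ {x : intDiffAlg K n} {p}, (∀ u, rightAct x (monomial u 1) = symbolAct u p) →
      x ≠ 0 → p.support.Nonempty := by
    intro x p hp hx
    rw [Finsupp.support_nonempty_iff]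
    rintro rfl
    exact hx (ext_rightAct fun u => by rw [hp, rightAct_zero, map_zero, LinearMap.zero_apply])
  obtain ⟨β, hβ, γ, hγ, huniq⟩ := UniqueSums.uniqueAdd_of_nonempty (hne hp h.1) (hne hq h.2)
  obtain ⟨q', hq'0, hq'⟩ := exists_shift β (q γ) (Finsupp.mem_support_iff.1 hγ)
  refine mul_ne_zero (Finsupp.mem_support_iff.1 hβ) hq'0 (eq_zero_of_eval_natCast fun u => ?_)
  have hu : rightAct (a * b) (monomial u 1) = 0 := by rw [hab, rightAct_zero, LinearMap.zero_apply]
  have hmon : ∀ (v : Fin n →₀ ℕ) (c : K), rightAct b (monomial v c) = c • symbolAct v q := by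
    intro v c
    rw [← hq, ← map_smul, smul_monomial, smul_eq_mul, mul_one]
  rw [rightAct_mul_apply, hp, symbolAct_apply, map_sum] at hu
  replace hu := congrArg (coeff (u + β + γ)) hu
  simp only [hmon, symbolAct_apply, Finset.smul_sum, smul_monomial, smul_eq_mul, coeff_sum,
    coeff_monomial, coeff_zero] at hu
  rw [Finset.sum_eq_single_of_mem β hβ, Finset.sum_eq_single_of_mem γ hγ, if_pos rfl] at hu
  · rw [map_mul, hq', hu]
  · intro γ' _ hne
    rw [if_neg]
    exact fun h => hne (add_left_cancel h)
  · intro β' hβ' hne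
    refine Finset.sum_eq_zero fun γ' hγ' => if_neg fun h => hne ?_
    rw [add_assoc, add_assoc] at h
    exact (huniq hβ' hγ' (add_left_cancel h)).1

/-- The powers of the generating space `⟨1, H_i, ∂_i⟩` have dimension at most `(m + 1)^{2n}`. -/
theorem algDelta_ore {r s : intDiffAlg K n} (hr : r ∈ algDelta K n) (hs : s ∈ algDelta K n)
    (hs0 : s ≠ 0) :
    ∃ a ∈ algDelta K n, ∃ b ∈ algDelta K n, a ≠ 0 ∧ a * r = b * s := by
  have h1 : (1 : intDiffAlg K n) ∈ Submodule.span K (insert 1 (deltaGen K n)) :=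
    Submodule.subset_span (Set.mem_insert _ _)
  have hmem' : ∀ {x}, (∃ m, x ∈ Submodule.span K (insert 1 (deltaGen K n)) ^ m) →
    x ∈ algDelta K n := fun ⟨m, hm⟩ => mem_adjoin_of_mem_pow hm
  have hfg : (Submodule.span K (insert 1 (deltaGen K n))).FG :=
    Submodule.fg_span (((Set.finite_range _).union (Set.finite_range _)).insert _)
  have hrank : ∀ m, Module.finrank K
      (Submodule.span K (insert 1 (deltaGen K n)) ^ m : Submodule K (intDiffAlg K n)) ≤
      (m + 1) ^ (2 * n) := fun m => by
    obtain ⟨h, hf⟩ := finrank_boxSpan_le (K := K) (n := n) m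
    exact (Submodule.finrank_mono (pow_span_deltaGen_le m)).trans h
  have := @exists_mul_eq_mul_of_growth K (intDiffAlg K n) _ _ _
    (Submodule.span K (insert 1 (deltaGen K n))) h1 hfg (2 * n) hrank
    (fun a b ha hb => algDelta_eq_zero_or_eq_zero (hmem' ha) (hmem' hb))
  obtain ⟨a, b, ha, hb, h0, h⟩ := this (exists_mem_pow_of_mem_algDelta hr)
    (exists_mem_pow_of_mem_algDelta hs) hs0
  refine ⟨a, hmem' ha, b, hmem' hb, h0, ?_⟩
  exact h

end Delta

/-! ### Left quotient rings -/

section LeftQuotientAPI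

variable {R : Type*} [Ring R] {S : Submonoid R} {h : IsLeftDenominator S}

namespace LeftQuotient

variable (K : Type*) [CommRing K] [Algebra K R]

/-- The canonical map `R → S⁻¹ R`. -/
noncomputable def of (h : IsLeftDenominator S) : R →ₐ[K] LeftQuotient S h :=
  letI := Classical.choice h.nonempty_oreSet
  { (OreLocalization.numeratorRingHom : R →+* OreLocalization S R) with
    commutes' := fun _ => rfl }

theorem isUnit_of {s : R} (hs : s ∈ S) : IsUnit (of K h s) :=
  let := Classical.choice h.nonempty_oreSet
  OreLocalization.numerator_isUnit (⟨s, hs⟩ : S)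

theorem exists_of_mul_eq (q : LeftQuotient S h) : ∃ s ∈ S, ∃ r, of K h s * q = of K h r := by
  let := Classical.choice h.nonempty_oreSet
  change OreLocalization S R at q
  induction q using OreLocalization.ind with
  | _ r s => exact ⟨s, s.2, r, OreLocalization.mul_cancel⟩

theorem of_eq_zero_iff {r : R} : of K h r = 0 ↔ ∃ s ∈ S, s * r = 0 := by
  let := Classical.choice h.nonempty_oreSet
  constructor
  · intro h0
    have h1 : OreLocalization.oreDiv r (1 : S) = 0 := h0
    rw [OreLocalization.zero_def, OreLocalization.oreDiv_eq_iff] at h1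
    obtain ⟨u, v, h1, h2⟩ := h1
    simp only [smul_zero, smul_eq_mul, OneMemClass.coe_one, mul_one] at h1 h2
    exact ⟨u, u.2, by rw [h2, ← h1]⟩
  · rintro ⟨s, hs, h0⟩
    have := (isUnit_of K (h := h) hs).mul_right_eq_zero (b := of K h r)
    rw [← this, ← map_mul, h0, map_zero]

/-- The universal property of the left quotient ring, for maps with trivial kernel that exhibit
their target as the ring of left fractions. -/
theorem nonempty_algEquiv {Q : Type*} [Ring Q] [Algebra K Q] (f : R →ₐ[K] Q)
    (hinj : Function.Injective f) (hunit : ∀ s ∈ S, IsUnit (f s))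
    (hsurj : ∀ q, ∃ s ∈ S, ∃ r, f s * q = f r) : Nonempty (LeftQuotient S h ≃ₐ[K] Q) := by
  let := Classical.choice h.nonempty_oreSet
  let fS : S →* Qˣ := IsUnit.liftRight ((f : R →* Q).comp S.subtype) fun s => hunit s s.2
  have hfS : ∀ s : S, (f : R →+* Q) s = fS s := fun s => rfl
  let g : LeftQuotient S h →+* Q := OreLocalization.universalHom (f : R →+* Q) fS hfS
  have hg : ∀ r, g (of K h r) = f r := fun r =>
    OreLocalization.universalHom_commutes (f : R →+* Q) fS hfS
  let g' : LeftQuotient S h →ₐ[K] Q :=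
    { g with
      commutes' := fun c => by
        have := hg (algebraMap K R c)
        rw [AlgHom.commutes, AlgHom.commutes] at this
        exact this }
  refine ⟨AlgEquiv.ofBijective g' ⟨?_, fun q => ?_⟩⟩
  · rw [injective_iff_map_eq_zero]
    intro q hq
    obtain ⟨s, hs, r, e⟩ := exists_of_mul_eq K q
    have hr : f r = 0 := by
      rw [← hg, ← e, map_mul]
      exact mul_eq_zero_of_right _ hq
    rw [(map_eq_zero_iff f hinj).1 hr, map_zero] at e
    exact (isUnit_of K hs).mul_right_eq_zero.1 e
  · obtain ⟨s, hs, r, e⟩ := hsurj q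
    obtain ⟨u, hu⟩ := isUnit_of K (h := h) hs
    refine ⟨↑u⁻¹ * of K h r, (hunit s hs).mul_left_cancel ?_⟩
    have h1 : f s = g' (of K h s) := (hg s).symm
    have h2 : f r = g' (of K h r) := (hg r).symm
    rw [e, h1, h2, ← map_mul, ← hu, Units.mul_inv_cancel_left]

end LeftQuotient

/-- The quotient ring of a left Ore domain is a division ring. -/
theorem LeftQuotient.isUnit_of_ne_zero [NoZeroDivisors R] [Nontrivial R]
    {h : IsLeftDenominator (nonZeroDivisors R)} {q : LeftQuotient _ h} (hq : q ≠ 0) :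
    IsUnit q := by
  obtain ⟨s, hs, r, e⟩ := exists_of_mul_eq ℤ q
  obtain ⟨u, hu⟩ := isUnit_of ℤ (h := h) hs
  have hr : r ≠ 0 := by
    rintro rfl
    rw [map_zero, ← hu] at e
    exact hq ((Units.mul_right_eq_zero u).1 e)
  have := isUnit_of ℤ (h := h) (mem_nonZeroDivisors_of_ne_zero hr)
  rw [← e, ← hu] at this
  exact (Units.isUnit_units_mul u q).1 this

end LeftQuotientAPI

/-! ### Rings obtained from a left Ore domain by inverting one normal element -/

section Frame

/-- `a` is killed by a power of `δ`, from the left. -/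
def IsPowTorsion {R : Type*} [Ring R] (δ a : R) : Prop := ∃ k : ℕ, δ ^ k * a = 0

/-- The subalgebra `D` of `R` is a left Ore domain, `δ ∈ D` is normal in `D` and has a right inverse
in `R`, and every element of `R` is multiplied into `D` by a power of `δ`. Hence the elements that
are killed by a power of `δ` form an ideal, and modulo this ideal `R` is `D` with `δ` inverted. -/
structure IsLeftOreFrame {K R : Type*} [Field K] [Ring R] [Algebra K R] (D : Subalgebra K R)
    (δ : R) : Prop where
  mem : δ ∈ D
  mul_comm_left : ∀ d ∈ D, ∃ d' ∈ D, δ * d = d' * δ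
  mul_comm_right : ∀ d ∈ D, ∃ d' ∈ D, d * δ = δ * d'
  right_inv : ∃ ε, δ * ε = 1
  exists_pow_mul_mem : ∀ a, ∃ k : ℕ, δ ^ k * a ∈ D
  domain : ∀ a ∈ D, ∀ b ∈ D, a * b = 0 → a = 0 ∨ b = 0
  ore : ∀ r ∈ D, ∀ s ∈ D, s ≠ 0 → ∃ a ∈ D, ∃ b ∈ D, a ≠ 0 ∧ a * r = b * s

theorem exists_pow_mul_eq_mul_pow {K R : Type*} [Field K] [Ring R] [Algebra K R]
    {D : Subalgebra K R} {δ : R} (h : ∀ d ∈ D, ∃ d' ∈ D, δ * d = d' * δ) {d : R} (hd : d ∈ D)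
    (k : ℕ) : ∃ d' ∈ D, δ ^ k * d = d' * δ ^ k := by
  induction k with
  | zero => exact ⟨d, hd, by simp⟩
  | succ k ih =>
    obtain ⟨d', hd', e⟩ := ih
    obtain ⟨d'', hd'', e'⟩ := h d' hd'
    exact ⟨d'', hd'', by rw [pow_succ', mul_assoc, e, ← mul_assoc, e', mul_assoc]⟩

namespace IsLeftOreFrame

variable {K R : Type*} [Field K] [Ring R] [Algebra K R] {D : Subalgebra K R} {δ : R}

theorem pow_mul_mem_of_le (F : IsLeftOreFrame D δ) {a : R} {k l : ℕ} (h : δ ^ k * a ∈ D)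
    (hkl : k ≤ l) : δ ^ l * a ∈ D := by
  obtain ⟨m, rfl⟩ := Nat.exists_eq_add_of_le' hkl
  rw [pow_add, mul_assoc]
  exact mul_mem (pow_mem F.mem m) h

theorem pow_mul_comm_left (F : IsLeftOreFrame D δ) {d : R} (hd : d ∈ D) (k : ℕ) :
    ∃ d' ∈ D, δ ^ k * d = d' * δ ^ k :=
  exists_pow_mul_eq_mul_pow F.mul_comm_left hd k

theorem pow_mul_comm_right (F : IsLeftOreFrame D δ) {d : R} (hd : d ∈ D) (k : ℕ) :
    ∃ d' ∈ D, d * δ ^ k = δ ^ k * d' := by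
  induction k with
  | zero => exact ⟨d, hd, by simp⟩
  | succ k ih =>
    obtain ⟨d', hd', e⟩ := ih
    obtain ⟨d'', hd'', e'⟩ := F.mul_comm_right d' hd'
    exact ⟨d'', hd'', by rw [pow_succ, ← mul_assoc, e, mul_assoc, e', mul_assoc]⟩

theorem pow_mem_leftRegular (F : IsLeftOreFrame D δ) (k : ℕ) : δ ^ k ∈ leftRegular R := by
  refine pow_mem (fun x hx => ?_) k
  obtain ⟨ε, hε⟩ := F.right_inv
  rw [← mul_one x, ← hε, ← mul_assoc, hx, zero_mul]

theorem pow_ne_zero [Nontrivial R] (F : IsLeftOreFrame D δ) (k : ℕ) : δ ^ k ≠ 0 := fun h =>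
  one_ne_zero (F.pow_mem_leftRegular k (1 : R) (by rw [h, mul_zero]))

theorem exists_pow_mul_eq (F : IsLeftOreFrame D δ) (a : R) (k : ℕ) :
    ∃ (m : ℕ) (a' : R), δ ^ m * a = a' * δ ^ k := by
  obtain ⟨l, hl⟩ := F.exists_pow_mul_mem a
  obtain ⟨d, -, e⟩ := F.pow_mul_comm_left hl k
  exact ⟨k + l, d, by rw [pow_add, mul_assoc, e]⟩

end IsLeftOreFrame

namespace IsPowTorsion

variable {K R : Type*} [Field K] [Ring R] [Algebra K R] {D : Subalgebra K R} {δ : R}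

theorem of_le {a : R} {k l : ℕ} (h : δ ^ k * a = 0) (hkl : k ≤ l) : δ ^ l * a = 0 := by
  obtain ⟨m, rfl⟩ := Nat.exists_eq_add_of_le' hkl
  rw [pow_add, mul_assoc, h, mul_zero]

theorem zero : IsPowTorsion δ (0 : R) := ⟨0, mul_zero _⟩

theorem add {a b : R} (ha : IsPowTorsion δ a) (hb : IsPowTorsion δ b) :
    IsPowTorsion δ (a + b) := by
  obtain ⟨k, hk⟩ := ha
  obtain ⟨l, hl⟩ := hb
  exact ⟨max k l, by rw [mul_add, of_le hk (le_max_left _ _), of_le hl (le_max_right _ _), add_zero]⟩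

theorem neg {a : R} (ha : IsPowTorsion δ a) : IsPowTorsion δ (-a) := by
  obtain ⟨k, hk⟩ := ha
  exact ⟨k, by rw [mul_neg, hk, neg_zero]⟩

theorem mul_right {a : R} (ha : IsPowTorsion δ a) (b : R) : IsPowTorsion δ (a * b) := by
  obtain ⟨k, hk⟩ := ha
  exact ⟨k, by rw [← mul_assoc, hk, zero_mul]⟩

/-- The torsion elements form a left ideal because the powers of `δ` satisfy the left Ore condition. -/
theorem mul_left (F : IsLeftOreFrame D δ) {a : R} (ha : IsPowTorsion δ a) (b : R) :
    IsPowTorsion δ (b * a) := by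
  obtain ⟨k, hk⟩ := ha
  obtain ⟨m, b', e⟩ := F.exists_pow_mul_eq b k
  exact ⟨m, by rw [← mul_assoc, e, mul_assoc, hk, mul_zero]⟩

theorem of_pow_mul {a : R} {k : ℕ} (h : IsPowTorsion δ (δ ^ k * a)) : IsPowTorsion δ a := by
  obtain ⟨l, hl⟩ := h
  exact ⟨l + k, by rw [pow_add, mul_assoc, hl]⟩

theorem eq_zero [Nontrivial R] (F : IsLeftOreFrame D δ) {d : R} (hd : d ∈ D)
    (h : IsPowTorsion δ d) : d = 0 := by
  obtain ⟨k, hk⟩ := h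
  exact (F.domain _ (pow_mem F.mem k) _ hd hk).resolve_left (F.pow_ne_zero k)

/-- The ideal of elements killed by a power of `δ` is completely prime. -/
theorem or_of_mul [Nontrivial R] (F : IsLeftOreFrame D δ) {a b : R}
    (h : IsPowTorsion δ (a * b)) : IsPowTorsion δ a ∨ IsPowTorsion δ b := by
  obtain ⟨k, hk⟩ := F.exists_pow_mul_mem a
  obtain ⟨l, hl⟩ := F.exists_pow_mul_mem b
  obtain ⟨d, hd, e⟩ := F.pow_mul_comm_left hk l
  have h1 : IsPowTorsion δ (d * (δ ^ l * b)) := by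
    rw [← mul_assoc, ← e, mul_assoc, mul_assoc]
    exact mul_left F (mul_left F h _) _
  rcases F.domain d hd _ hl (h1.eq_zero F (mul_mem hd hl)) with h0 | h0
  · left
    rw [h0, zero_mul] at e
    exact of_pow_mul ⟨l, e⟩
  · exact Or.inr ⟨l, h0⟩

theorem not_of_mem_leftRegular [Nontrivial R] (F : IsLeftOreFrame D δ) {c : R}
    (hc : c ∈ leftRegular R) : ¬ IsPowTorsion δ c := fun ⟨k, hk⟩ =>
  F.pow_ne_zero k (hc _ hk)

end IsPowTorsion

namespace IsLeftOreFrame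

variable {K R : Type*} [Field K] [Ring R] [Algebra K R] {D : Subalgebra K R} {δ : R}

/-- The left Ore condition for `R` modulo the torsion ideal. The common left multiple exists already
in `R`, and the left factor of `r` lies outside the ideal because `D` is torsion-free. -/
theorem exists_mul_eq_mul [Nontrivial R] (F : IsLeftOreFrame D δ) (r : R) {s : R}
    (hs : ¬ IsPowTorsion δ s) : ∃ a ∈ D, ∃ b ∈ D, a ≠ 0 ∧ a * r = b * s := by
  obtain ⟨k₁, hk₁⟩ := F.exists_pow_mul_mem r
  obtain ⟨k₂, hk₂⟩ := F.exists_pow_mul_mem s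
  set k := max k₁ k₂
  have hk : δ ^ k ∈ D := pow_mem F.mem k
  obtain ⟨a, ha, b, hb, ha0, e⟩ := F.ore _ (F.pow_mul_mem_of_le hk₁ (le_max_left _ _)) _
    (F.pow_mul_mem_of_le hk₂ (le_max_right _ _)) fun h => hs ⟨k, h⟩
  refine ⟨a * δ ^ k, mul_mem ha hk, b * δ ^ k, mul_mem hb hk, fun h => ?_, ?_⟩
  · exact ((F.domain _ ha _ hk h).resolve_left ha0) |> F.pow_ne_zero k
  · rw [mul_assoc, e, mul_assoc]

/-- The powers of `δ` form a left denominator set of left regular elements. -/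
theorem mem_leftRegDenominator [Nontrivial R] (F : IsLeftOreFrame D δ) :
    δ ∈ leftRegDenominator R := by
  suffices h : IsLeftDenominator (Submonoid.powers δ) ∧ Submonoid.powers δ ≤ leftRegular R from
    isGreatest_leftRegDenominator.2 h (Submonoid.mem_powers δ)
  refine ⟨⟨?_, ?_, ?_⟩, ?_⟩
  · rintro ⟨k, hk⟩
    exact F.pow_ne_zero k hk
  · rintro r _ ⟨k, rfl⟩
    obtain ⟨m, r', e⟩ := F.exists_pow_mul_eq r k
    exact ⟨_, ⟨m, rfl⟩, r', e⟩
  · rintro r _ ⟨k, rfl⟩ h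
    exact ⟨1, one_mem _, by rw [F.pow_mem_leftRegular k r h, mul_zero]⟩
  · rintro _ ⟨k, rfl⟩
    exact F.pow_mem_leftRegular k

/-- Modulo the ideal of elements killed by a power of `δ`, the condition that each element has a
left multiple in a submonoid containing `δ` can be stated without passing to the quotient. -/
theorem isLeftDense_image_iff [Nontrivial R] (F : IsLeftOreFrame D δ) {B : Type*} [Ring B]
    {π : R →+* B} (hπ : Function.Surjective π) (hker : ∀ a, π a = 0 ↔ IsPowTorsion δ a)
    {T : Submonoid R} (hδ : δ ∈ T) (hT : T ≤ leftRegular R) :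
    IsLeftDense (π '' T) {b | b ≠ 0} ↔ ∀ a, ¬ IsPowTorsion δ a → ∃ b, b * a ∈ T := by
  have hT0 : ∀ t ∈ T, π t ≠ 0 := fun t ht h =>
    IsPowTorsion.not_of_mem_leftRegular F (hT ht) ((hker t).1 h)
  constructor
  · intro h a ha
    obtain ⟨b, t, ht, e⟩ := h.dense (π a) fun h0 => ha ((hker a).1 h0)
    obtain ⟨b, rfl⟩ := hπ b
    have hta : IsPowTorsion δ (t - b * a) := by
      rw [← hker, map_sub, map_mul, e, sub_self]
    obtain ⟨k, hk⟩ := hta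
    rw [mul_sub, sub_eq_zero] at hk
    exact ⟨δ ^ k * b, by rw [mul_assoc, ← hk]; exact mul_mem (pow_mem hδ k) ht⟩
  · intro h
    refine ⟨⟨⟨1, one_mem T, map_one π⟩, ?_, ?_⟩, ⟨?_, ?_, fun h0 => h0 rfl⟩, ?_, ?_⟩
    · rintro _ ⟨a, ha, rfl⟩ _ ⟨b, hb, rfl⟩
      exact ⟨a * b, mul_mem ha hb, map_mul π a b⟩
    · rintro ⟨t, ht, h0⟩
      exact hT0 t ht h0
    · have := hT0 1 (one_mem T)
      rwa [map_one] at this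
    · intro a ha b hb hab
      obtain ⟨a, rfl⟩ := hπ a
      obtain ⟨b, rfl⟩ := hπ b
      rw [← map_mul, hker] at hab
      rcases hab.or_of_mul F with h | h
      · exact ha ((hker a).2 h)
      · exact hb ((hker b).2 h)
    · rintro _ ⟨t, ht, rfl⟩
      exact hT0 t ht
    · intro b hb
      obtain ⟨a, rfl⟩ := hπ b
      obtain ⟨b, hb⟩ := h a fun h0 => hb ((hker a).2 h0)
      exact ⟨π b, b * a, hb, map_mul π b a⟩

/-- The same reduction for denseness inside `D`. -/
theorem isLeftDense_subalgebra_iff [Nontrivial R] (F : IsLeftOreFrame D δ) {T : Submonoid R}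
    (hT : T ≤ leftRegular R) :
    IsLeftDense {d : D | (d : R) ∈ D.toSubmonoid ⊓ T} {d | d ≠ 0} ↔
      ∀ d ∈ D, d ≠ 0 → ∃ r ∈ D, r * d ∈ T := by
  have hT0 : (0 : R) ∉ T := fun h => one_ne_zero (hT h (1 : R) (mul_zero _))
  constructor
  · intro h d hd hd0
    obtain ⟨r, hr⟩ := h.dense ⟨d, hd⟩ fun h => hd0 (congrArg Subtype.val h)
    exact ⟨r, r.2, hr.2⟩
  · intro h
    refine ⟨⟨⟨one_mem D, one_mem T⟩, fun a ha b hb => ⟨mul_mem ha.1 hb.1, mul_mem ha.2 hb.2⟩,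
      fun h0 => hT0 h0.2⟩, ⟨?_, ?_, fun h0 => h0 rfl⟩, ?_, ?_⟩
    · exact fun h1 => one_ne_zero (congrArg Subtype.val h1 : (1 : R) = 0)
    · intro a ha b hb hab
      rcases F.domain a a.2 b b.2 (congrArg Subtype.val hab) with h0 | h0
      · exact ha (Subtype.ext h0)
      · exact hb (Subtype.ext h0)
    · rintro d ⟨-, hd⟩ rfl
      exact hT0 hd
    · intro d hd
      obtain ⟨r, hr, hrd⟩ := h d d.2 fun h => hd (Subtype.ext h)
      exact ⟨⟨r, hr⟩, mul_mem hr d.2, hrd⟩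

/-- Modulo the torsion ideal `R` is a domain, so a subring that meets the ideal trivially has no zero
divisors. -/
theorem noZeroDivisors_of_embedding [Nontrivial R] (F : IsLeftOreFrame D δ) {W : Type*} [Ring W]
    [Algebra K W] (ι : W →ₐ[K] R) (hι : ∀ w, IsPowTorsion δ (ι w) → w = 0) : NoZeroDivisors W where
  eq_zero_or_eq_zero_of_mul_eq_zero {a b} hab := by
    have h : IsPowTorsion δ (ι a * ι b) := by
      rw [← map_mul, hab, map_zero]
      exact IsPowTorsion.zero
    exact (h.or_of_mul F).imp (hι a) (hι b)

/-- The Ore condition of `D` passes to any subring `W` that contains `D` and avoids the torsion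
ideal. -/
theorem isLeftDenominator_of_embedding [Nontrivial R] (F : IsLeftOreFrame D δ) {W : Type*} [Ring W]
    [Algebra K W] (ι : W →ₐ[K] R) (hι : ∀ w, IsPowTorsion δ (ι w) → w = 0)
    (hD : D ≤ ι.range) : IsLeftDenominator (nonZeroDivisors W) := by
  have := F.noZeroDivisors_of_embedding ι hι
  have : Nontrivial W := ι.toRingHom.domain_nontrivial
  have hinj : Function.Injective ι := (injective_iff_map_eq_zero ι).2 fun w hw =>
    hι w (hw ▸ IsPowTorsion.zero)
  refine ⟨zero_notMem_nonZeroDivisors, fun r s hs => ?_, fun r s hs h => ?_⟩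
  · obtain ⟨a, ha, b, hb, ha0, e⟩ := F.exists_mul_eq_mul (ι r) (s := ι s)
      fun h => nonZeroDivisors.ne_zero hs (hι s h)
    obtain ⟨a, rfl⟩ := hD ha
    obtain ⟨b, rfl⟩ := hD hb
    refine ⟨a, mem_nonZeroDivisors_of_ne_zero ?_, b, hinj ?_⟩
    · rintro rfl
      exact ha0 (map_zero ι)
    · rw [map_mul, map_mul]
      exact e
  · exact ⟨1, one_mem _, by
      rw [(mul_eq_zero.1 h).resolve_right (nonZeroDivisors.ne_zero hs), mul_zero]⟩

section Quotient

variable [Nontrivial R] {S : Submonoid R} {h : IsLeftDenominator S}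

/-- If every element outside the torsion ideal has a left multiple in `S`, then all these elements
become invertible in `S⁻¹ R`. -/
theorem isUnit_of_of_forall_exists (F : IsLeftOreFrame D δ)
    (hS : S ≤ leftRegular R) (hd : ∀ a, ¬ IsPowTorsion δ a → ∃ b, b * a ∈ S)
    {a : R} (ha : ¬ IsPowTorsion δ a) : IsUnit (LeftQuotient.of K h a) := by
  have hleft : ∀ {a : R}, ¬ IsPowTorsion δ a → ∃ q, q * LeftQuotient.of K h a = 1 := by
    intro a ha
    obtain ⟨b, hb⟩ := hd a ha
    obtain ⟨u, hu⟩ := LeftQuotient.isUnit_of K (h := h) hb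
    exact ⟨↑u⁻¹ * LeftQuotient.of K h b, by rw [mul_assoc, ← map_mul, ← hu, Units.inv_mul]⟩
  obtain ⟨b, hb⟩ := hd a ha
  -- The multiplier `b` is itself outside the ideal, so it has inverses on both sides.
  have hb0 : ¬ IsPowTorsion δ b := fun h0 =>
    IsPowTorsion.not_of_mem_leftRegular F (hS hb) (h0.mul_right a)
  obtain ⟨u, hu⟩ := LeftQuotient.isUnit_of K (h := h) hb
  rw [map_mul] at hu
  obtain ⟨q, hq⟩ := hleft hb0
  have hr : LeftQuotient.of K h b * (LeftQuotient.of K h a * ↑u⁻¹) = 1 := by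
    rw [← mul_assoc, ← hu, Units.mul_inv]
  have hb1 : IsUnit (LeftQuotient.of K h b) :=
    isUnit_iff_exists_and_exists.2 ⟨⟨_, hr⟩, ⟨_, hq⟩⟩
  obtain ⟨v, hv⟩ := hb1
  rw [← hv] at hu
  exact (Units.isUnit_units_mul v _).1 ⟨u, hu⟩

/-- If every element outside the torsion ideal has a left multiple in `S`, then `S⁻¹ R` is the
quotient ring of `W`: both are obtained from `D` by inverting all nonzero elements. -/
theorem nonempty_algEquiv_of_forall_exists (F : IsLeftOreFrame D δ)
    (hS : S ≤ leftRegular R) (hd : ∀ a, ¬ IsPowTorsion δ a → ∃ b, b * a ∈ S)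
    {W : Type*} [Ring W] [Algebra K W] (ι : W →ₐ[K] R) (hι : ∀ w, IsPowTorsion δ (ι w) → w = 0)
    (hD : D ≤ ι.range) (hW : IsLeftDenominator (nonZeroDivisors W)) :
    Nonempty (LeftQuotient S h ≃ₐ[K] LeftQuotient _ hW) := by
  have := F.noZeroDivisors_of_embedding ι hι
  have : Nontrivial W := ι.toRingHom.domain_nontrivial
  have hunit : ∀ w, w ≠ 0 → IsUnit (LeftQuotient.of K h (ι w)) := fun w hw =>
    F.isUnit_of_of_forall_exists hS hd fun h0 => hw (hι w h0)
  refine (LeftQuotient.nonempty_algEquiv K (h := hW) ((LeftQuotient.of K h).comp ι) ?_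
    (fun w hw => hunit w (nonZeroDivisors.ne_zero hw)) fun q => ?_).map AlgEquiv.symm
  · rw [injective_iff_map_eq_zero]
    intro w hw
    obtain ⟨s, hs, e⟩ := (LeftQuotient.of_eq_zero_iff K).1 hw
    have h1 : IsPowTorsion δ (s * ι w) := e ▸ IsPowTorsion.zero
    exact hι w ((h1.or_of_mul F).resolve_left (IsPowTorsion.not_of_mem_leftRegular F (hS hs)))
  · obtain ⟨s, hs, r, e⟩ := LeftQuotient.exists_of_mul_eq K q
    obtain ⟨k₁, hk₁⟩ := F.exists_pow_mul_mem s
    obtain ⟨k₂, hk₂⟩ := F.exists_pow_mul_mem r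
    obtain ⟨w₁, hw₁⟩ := hD (F.pow_mul_mem_of_le hk₁ (le_max_left _ k₂))
    obtain ⟨w₂, hw₂⟩ := hD (F.pow_mul_mem_of_le hk₂ (le_max_right k₁ _))
    change ι w₁ = _ at hw₁
    change ι w₂ = _ at hw₂
    refine ⟨w₁, mem_nonZeroDivisors_of_ne_zero ?_, w₂, ?_⟩
    · rintro rfl
      rw [map_zero] at hw₁
      exact IsPowTorsion.not_of_mem_leftRegular F (hS hs) ⟨_, hw₁.symm⟩
    · rw [AlgHom.comp_apply, AlgHom.comp_apply, hw₁, hw₂, map_mul, map_mul, mul_assoc, e]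

/-- If all nonzero elements of `S⁻¹ R` are invertible, then every element outside the torsion ideal
has a left multiple in `S`. -/
theorem forall_exists_of_isUnit (F : IsLeftOreFrame D δ) (hS : S ≤ leftRegular R)
    (hu : ∀ q : LeftQuotient S h, q ≠ 0 → IsUnit q) {a : R} (ha : ¬ IsPowTorsion δ a) :
    ∃ b, b * a ∈ S := by
  have h0 : LeftQuotient.of K h a ≠ 0 := by
    intro h0
    obtain ⟨s, hs, e⟩ := (LeftQuotient.of_eq_zero_iff K).1 h0
    have h1 : IsPowTorsion δ (s * a) := e ▸ IsPowTorsion.zero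
    exact ha ((h1.or_of_mul F).resolve_left (IsPowTorsion.not_of_mem_leftRegular F (hS hs)))
  obtain ⟨u, hu⟩ := hu _ h0
  obtain ⟨s, hs, r, e⟩ := LeftQuotient.exists_of_mul_eq K (↑u⁻¹ : LeftQuotient S h)
  have h1 : LeftQuotient.of K h (r * a - s) = 0 := by
    rw [map_sub, map_mul, ← e, mul_assoc, ← hu, Units.inv_mul, mul_one, sub_self]
  obtain ⟨t, ht, h2⟩ := (LeftQuotient.of_eq_zero_iff K).1 h1
  rw [mul_sub, sub_eq_zero] at h2
  exact ⟨t * r, by rw [mul_assoc, h2]; exact mul_mem ht hs⟩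

end Quotient

/-- If every element outside the torsion ideal has a left regular left multiple, then the left
regular elements form a left denominator set. -/
theorem isLeftDenominator_leftRegular [Nontrivial R] (F : IsLeftOreFrame D δ)
    (hd : ∀ a, ¬ IsPowTorsion δ a → ∃ b, b * a ∈ leftRegular R) :
    IsLeftDenominator (leftRegular R) := by
  refine ⟨fun h0 => one_ne_zero (h0 (1 : R) (mul_zero _)), fun r c hc => ?_, fun r c hc h0 =>
    ⟨1, one_mem _, by rw [hc r h0, mul_zero]⟩⟩
  obtain ⟨a, ha, b, -, ha0, e⟩ := F.exists_mul_eq_mul r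
    (IsPowTorsion.not_of_mem_leftRegular F hc)
  obtain ⟨b', hb'⟩ := hd a fun h => ha0 (h.eq_zero F ha)
  exact ⟨b' * a, hb', b' * b, by rw [mul_assoc, e, mul_assoc]⟩

/-- The equivalences for an abstract frame. Each condition amounts to the existence of left multiples
in `'S(R)` or in `'C_R` for all elements outside the torsion ideal; the two agree, since in the second
case `'C_R` satisfies the Ore condition and hence equals `'S(R)`. -/
theorem tfae [Nontrivial R] (F : IsLeftOreFrame D δ) {W : Type*} [Ring W] [Algebra K W]
    (ι : W →ₐ[K] R) (hι : ∀ w, IsPowTorsion δ (ι w) → w = 0) (hD : D ≤ ι.range)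
    (hW : IsLeftDenominator (nonZeroDivisors W)) {B : Type*} [Ring B]
    {π : R →+* B} (hπ : Function.Surjective π) (hker : ∀ a, π a = 0 ↔ IsPowTorsion δ a) :
    List.TFAE [
      Nonempty (LeftRegQuotient R ≃+* LeftQuotient _ hW),
      Nonempty (LeftRegQuotient R ≃ₐ[K] LeftQuotient _ hW),
      ∃ h : IsLeftDenominator (leftRegular R), Nonempty (LeftQuotient _ h ≃+* LeftQuotient _ hW),
      ∃ h : IsLeftDenominator (leftRegular R), Nonempty (LeftQuotient _ h ≃ₐ[K] LeftQuotient _ hW),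
      IsLeftDense (π '' (leftRegDenominator R)) {b | b ≠ 0},
      IsLeftDense (π '' (leftRegular R)) {b | b ≠ 0},
      IsLeftDense (π '' (D.toSubmonoid ⊓ leftRegDenominator R : Submonoid R)) {b | b ≠ 0},
      IsLeftDense {d : D | (d : R) ∈ D.toSubmonoid ⊓ leftRegDenominator R} {d | d ≠ 0},
      ∀ s ∈ D, s ≠ 0 → ∃ s' ∈ D, s' ≠ 0 ∧ s' * s ∈ leftRegular R] := by
  have := F.noZeroDivisors_of_embedding ι hι
  have : Nontrivial W := ι.toRingHom.domain_nontrivial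
  have hδ := F.mem_leftRegDenominator
  have hSC := leftRegDenominator_le (R := R)
  have hk : ∀ (k : ℕ) {b : R}, b ∈ leftRegDenominator R → δ ^ k * b ∈ leftRegDenominator R :=
    fun k _ hb => mul_mem (pow_mem hδ k) hb
  have hCeq : IsLeftDenominator (leftRegular R) → leftRegular R = leftRegDenominator R :=
    fun h => le_antisymm (isGreatest_leftRegDenominator.2 ⟨h, le_rfl⟩) hSC
  rw [F.isLeftDense_image_iff hπ hker hδ hSC,
    F.isLeftDense_image_iff hπ hker (hSC hδ) le_rfl,
    F.isLeftDense_image_iff hπ hker (Submonoid.mem_inf.2 ⟨F.mem, hδ⟩) (inf_le_right.trans hSC),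
    F.isLeftDense_subalgebra_iff hSC]
  tfae_have 1 → 5 := by
    rintro ⟨e⟩ a ha
    refine F.forall_exists_of_isUnit (h := isLeftDenominator_leftRegDenominator) hSC
      (fun q hq => ?_) ha
    have := LeftQuotient.isUnit_of_ne_zero (q := e q) ((map_ne_zero_iff e e.injective).2 hq)
    simpa using this.map e.symm
  tfae_have 5 → 2 := fun h =>
    F.nonempty_algEquiv_of_forall_exists hSC h ι hι hD hW
  tfae_have 2 → 1 := fun ⟨e⟩ => ⟨e.toRingEquiv⟩
  tfae_have 4 → 3 := fun ⟨h, ⟨e⟩⟩ => ⟨h, ⟨e.toRingEquiv⟩⟩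
  tfae_have 3 → 1 := by
    rintro ⟨h, he⟩
    have key : ∀ (S : Submonoid R) (hS : IsLeftDenominator S), S = leftRegDenominator R →
        Nonempty (LeftQuotient S hS ≃+* LeftQuotient _ hW) →
        Nonempty (LeftRegQuotient R ≃+* LeftQuotient _ hW) := by
      rintro S hS rfl he
      exact he
    exact key _ h (hCeq h) he
  tfae_have 6 → 4 := fun h =>
    have hC := F.isLeftDenominator_leftRegular h
    ⟨hC, F.nonempty_algEquiv_of_forall_exists le_rfl h ι hι hD hW⟩
  -- Multiplication by a power of `δ` moves elements into `D` without leaving `'S(R)`.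
  tfae_have 5 → 7 := by
    intro h a ha
    obtain ⟨b, hb⟩ := h a ha
    obtain ⟨k, hk'⟩ := F.exists_pow_mul_mem (b * a)
    exact ⟨δ ^ k * b, by rw [mul_assoc]; exact ⟨hk', hk k hb⟩⟩
  tfae_have 7 → 8 := by
    intro h d hd hd0
    obtain ⟨b, hb⟩ := h d fun h0 => hd0 (h0.eq_zero F hd)
    obtain ⟨k, hk'⟩ := F.exists_pow_mul_mem b
    exact ⟨_, hk', by rw [mul_assoc]; exact hk k hb.2⟩
  tfae_have 8 → 9 := by
    intro h d hd hd0
    obtain ⟨r, hr, hrd⟩ := h d hd hd0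
    refine ⟨r, hr, ?_, hSC hrd⟩
    rintro rfl
    rw [zero_mul] at hrd
    exact one_ne_zero (hSC hrd (1 : R) (mul_zero _))
  tfae_have 9 → 6 := by
    intro h a ha
    obtain ⟨k, hk'⟩ := F.exists_pow_mul_mem a
    obtain ⟨r, -, -, hr⟩ := h _ hk' fun h0 => ha ⟨k, h0⟩
    exact ⟨r * δ ^ k, by rwa [mul_assoc]⟩
  tfae_finish

end IsLeftOreFrame

end Frame

/-! ### The algebra `𝕀_n` modulo `𝔞_n` -/

section Frame

open MvPolynomial

variable {K : Type*} [Field K] {n : ℕ}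

theorem elH_mem_algDelta (i : Fin n) : elH K n i ∈ algDelta K n :=
  Algebra.subset_adjoin (Or.inl ⟨i, rfl⟩)

theorem elD_mem_algDelta (i : Fin n) : elD K n i ∈ algDelta K n :=
  Algebra.subset_adjoin (Or.inr ⟨i, rfl⟩)

theorem elH_sub_one_mem_algDelta (i : Fin n) : elH K n i - 1 ∈ algDelta K n :=
  Subalgebra.sub_mem (R := K) (A := intDiffAlg K n) _ (elH_mem_algDelta i) (Subalgebra.one_mem _)

theorem elDD_mem_algDelta (β : Fin n →₀ ℕ) : elDD K β ∈ algDelta K n := by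
  refine Subalgebra.list_prod_mem _ fun x hx => ?_
  obtain ⟨i, rfl⟩ := (List.mem_ofFn' _ _).1 hx
  exact pow_mem (elD_mem_algDelta i) _

theorem intDiffAlg_induction {P : intDiffAlg K n → Prop} (hX : ∀ i, P (elX K n i))
    (hD : ∀ i, P (elD K n i)) (hI : ∀ i, P (elI K n i)) (hc : ∀ c, P (algebraMap K _ c))
    (hadd : ∀ a b, P a → P b → P (a + b)) (hmul : ∀ a b, P a → P b → P (a * b))
    (a : intDiffAlg K n) : P a := by
  obtain ⟨a, ha⟩ := a
  refine Algebra.adjoin_induction (p := fun x hx => P ⟨x, hx⟩) ?_ hc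
    (fun x y hx hy => hadd ⟨x, hx⟩ ⟨y, hy⟩) (fun x y hx hy => hmul ⟨x, hx⟩ ⟨y, hy⟩) ha
  rintro x ((⟨i, rfl⟩ | ⟨i, rfl⟩) | ⟨i, rfl⟩)
  exacts [hX i, hD i, hI i]

theorem weylAlg_induction {P : weylAlg K n → Prop}
    (hX : ∀ i h, P ⟨opX K n i, h⟩) (hD : ∀ i h, P ⟨opD K n i, h⟩) (hc : ∀ c, P (algebraMap K _ c))
    (hadd : ∀ a b, P a → P b → P (a + b)) (hmul : ∀ a b, P a → P b → P (a * b))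
    (a : weylAlg K n) : P a := by
  obtain ⟨a, ha⟩ := a
  refine Algebra.adjoin_induction (p := fun x hx => P ⟨x, hx⟩) ?_ hc
    (fun x y hx hy => hadd ⟨x, hx⟩ ⟨y, hy⟩) (fun x y hx hy => hmul ⟨x, hx⟩ ⟨y, hy⟩) ha
  rintro x (⟨i, rfl⟩ | ⟨i, rfl⟩)
  exacts [hX i _, hD i _]

variable (K n) in
/-- The product `∂_1 ⋯ ∂_n`, the element that is inverted when passing to `B_n`. -/
noncomputable def elDelta : intDiffAlg K n := elDD K (Finsupp.equivFunOnFinite.symm 1)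

variable (K n) in
/-- The inclusion of the Weyl algebra into `𝕀_n`. -/
noncomputable def weylIncl : weylAlg K n →ₐ[K] intDiffAlg K n :=
  Subalgebra.inclusion (Algebra.adjoin_mono Set.subset_union_left)

theorem algDelta_le_range_weylIncl : algDelta K n ≤ (weylIncl K n).range := by
  have hD : ∀ i, elD K n i ∈ (weylIncl K n).range := fun i =>
    ⟨⟨opD K n i, Algebra.subset_adjoin (Or.inr ⟨i, rfl⟩)⟩, rfl⟩
  have hX : ∀ i, elX K n i ∈ (weylIncl K n).range := fun i =>
    ⟨⟨opX K n i, Algebra.subset_adjoin (Or.inl ⟨i, rfl⟩)⟩, rfl⟩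
  refine Algebra.adjoin_le ?_
  rintro _ (⟨i, rfl⟩ | ⟨i, rfl⟩)
  · exact mul_mem (hD i) (hX i)
  · exact hD i

theorem toB_eq_zero_iff_mem (a : intDiffAlg K n) : toB K n a = 0 ↔ a ∈ idealA K n :=
  (RingCon.eq _).trans (TwoSidedIdeal.mem_iff _ a).symm

variable [CharZero K]

theorem elD_mul_elI (i : Fin n) : elD K n i * elI K n i = 1 :=
  ext_rightAct fun u => by
    rw [rightAct_mul_apply, rightAct_elD_monomial, rightAct_elI_monomial, if_neg (by simp),
      add_tsub_cancel_right, rightAct_one, Module.End.one_apply]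

theorem rightAct_elDelta_monomial (u : Fin n →₀ ℕ) (c : K) :
    rightAct (elDelta K n) (monomial u c) =
      monomial (u + Finsupp.equivFunOnFinite.symm 1) c :=
  rightAct_elDD_monomial _ _ _

theorem elDelta_mul_elH (i : Fin n) :
    elDelta K n * elH K n i = (elH K n i + 1) * elDelta K n :=
  ext_rightAct fun u => by
    rw [rightAct_mul_apply, rightAct_mul_apply, rightAct_add, LinearMap.add_apply, map_add,
      rightAct_one, Module.End.one_apply, rightAct_elH_monomial, rightAct_elDelta_monomial,
      rightAct_elDelta_monomial, rightAct_elH_monomial, ← map_add]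
    congr 1
    simp

theorem elH_mul_elDelta (i : Fin n) :
    elH K n i * elDelta K n = elDelta K n * (elH K n i - 1) :=
  ext_rightAct fun u => by
    rw [rightAct_mul_apply, rightAct_mul_apply, rightAct_sub, LinearMap.sub_apply,
      rightAct_one, Module.End.one_apply, rightAct_elH_monomial, rightAct_elDelta_monomial,
      rightAct_elDelta_monomial, rightAct_elH_monomial, ← map_sub]
    congr 1
    simp

theorem elDelta_mul_elD (i : Fin n) :
    elDelta K n * elD K n i = elD K n i * elDelta K n :=
  ext_rightAct fun u => by
    rw [rightAct_mul_apply, rightAct_mul_apply, rightAct_elD_monomial, rightAct_elDelta_monomial,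
      rightAct_elDelta_monomial, rightAct_elD_monomial, add_right_comm]

theorem ones_eq_add_single (i : Fin n) : (Finsupp.equivFunOnFinite.symm 1 : Fin n →₀ ℕ) =
    Finsupp.equivFunOnFinite.symm 1 - Finsupp.single i 1 + Finsupp.single i 1 := by
  rw [tsub_add_cancel_of_le]
  rw [Finsupp.single_le_iff]
  simp

/-- A factor `∂_i` of `∂_1 ⋯ ∂_n` absorbs `x_i`, as `∂_i x_i = H_i`. -/
theorem elDelta_mul_elX (i : Fin n) : elDelta K n * elX K n i =
    elDD K (Finsupp.equivFunOnFinite.symm 1 - Finsupp.single i 1) * elH K n i :=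
  ext_rightAct fun u => by
    rw [rightAct_mul_apply, rightAct_mul_apply, rightAct_elDelta_monomial, rightAct_elX_monomial,
      rightAct_elDD_monomial, rightAct_elH_monomial]
    conv_lhs => rw [ones_eq_add_single i, ← add_assoc, add_tsub_cancel_right]
    congr 1
    simp

theorem elX_mul_elDelta (i : Fin n) : elX K n i * elDelta K n =
    (elH K n i - 1) * elDD K (Finsupp.equivFunOnFinite.symm 1 - Finsupp.single i 1) :=
  ext_rightAct fun u => by
    rw [rightAct_mul_apply, rightAct_mul_apply, rightAct_sub, LinearMap.sub_apply,
      rightAct_elH_monomial, rightAct_one, Module.End.one_apply, ← map_sub, rightAct_elX_monomial,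
      rightAct_elDelta_monomial, rightAct_elDD_monomial]
    -- If `u_i = 0`, the truncated exponents on the two sides differ, but both coefficients vanish.
    by_cases h : u i = 0
    · simp [h]
    · have hu : u = u - Finsupp.single i 1 + Finsupp.single i 1 := by
        rw [tsub_add_cancel_of_le]
        rw [Finsupp.single_le_iff]
        omega
      conv_lhs => rw [ones_eq_add_single i, add_comm _ (Finsupp.single i 1), ← add_assoc, ← hu]
      congr 1
      ring

theorem elDelta_mul_elI (i : Fin n) : elDelta K n * elI K n i =
    elDD K (Finsupp.equivFunOnFinite.symm 1 - Finsupp.single i 1) :=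
  ext_rightAct fun u => by
    rw [rightAct_mul_apply, rightAct_elDelta_monomial, rightAct_elI_monomial, if_neg (by simp),
      rightAct_elDD_monomial]
    conv_lhs => rw [ones_eq_add_single i, ← add_assoc, add_tsub_cancel_right]

theorem elDelta_mul_comm_left {d : intDiffAlg K n} (hd : d ∈ algDelta K n) :
    ∃ d' ∈ algDelta K n, elDelta K n * d = d' * elDelta K n := by
  induction hd using Algebra.adjoin_induction with
  | mem x hx =>
    rcases hx with ⟨i, rfl⟩ | ⟨i, rfl⟩
    · exact ⟨_, add_mem (elH_mem_algDelta i) (one_mem _), elDelta_mul_elH i⟩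
    · exact ⟨_, elD_mem_algDelta i, elDelta_mul_elD i⟩
  | algebraMap c => exact ⟨_, Subalgebra.algebraMap_mem _ c, (Algebra.commutes c _).symm⟩
  | add x y _ _ hx hy =>
    obtain ⟨x', hx', ex⟩ := hx
    obtain ⟨y', hy', ey⟩ := hy
    exact ⟨x' + y', add_mem hx' hy', by rw [mul_add, ex, ey, add_mul]⟩
  | mul x y _ _ hx hy =>
    obtain ⟨x', hx', ex⟩ := hx
    obtain ⟨y', hy', ey⟩ := hy
    exact ⟨x' * y', mul_mem hx' hy', by rw [← mul_assoc, ex, mul_assoc, ey, mul_assoc]⟩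

theorem elDelta_mul_comm_right {d : intDiffAlg K n} (hd : d ∈ algDelta K n) :
    ∃ d' ∈ algDelta K n, d * elDelta K n = elDelta K n * d' := by
  induction hd using Algebra.adjoin_induction with
  | mem x hx =>
    rcases hx with ⟨i, rfl⟩ | ⟨i, rfl⟩
    · exact ⟨_, elH_sub_one_mem_algDelta i, elH_mul_elDelta i⟩
    · exact ⟨_, elD_mem_algDelta i, (elDelta_mul_elD i).symm⟩
  | algebraMap c => exact ⟨_, Subalgebra.algebraMap_mem _ c, Algebra.commutes c _⟩
  | add x y _ _ hx hy =>
    obtain ⟨x', hx', ex⟩ := hx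
    obtain ⟨y', hy', ey⟩ := hy
    exact ⟨x' + y', add_mem hx' hy', by rw [add_mul, ex, ey, mul_add]⟩
  | mul x y _ _ hx hy =>
    obtain ⟨x', hx', ex⟩ := hx
    obtain ⟨y', hy', ey⟩ := hy
    exact ⟨x' * y', mul_mem hx' hy', by rw [mul_assoc, ey, ← mul_assoc, ex, mul_assoc]⟩

theorem elDelta_right_inv : ∃ ε, elDelta K n * ε = 1 := by
  have key : ∀ l : List (intDiffAlg K n), (∀ x ∈ l, ∃ i, ∃ k : ℕ, x = elD K n i ^ k) →
      ∃ ε, l.prod * ε = 1 := by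
    intro l
    induction l with
    | nil => exact fun _ => ⟨1, by simp⟩
    | cons x l ih =>
      intro h
      obtain ⟨ε, hε⟩ := ih fun y hy => h y (List.mem_cons_of_mem _ hy)
      obtain ⟨i, k, rfl⟩ := h x List.mem_cons_self
      have hx : ∀ k : ℕ, elD K n i ^ k * elI K n i ^ k = 1 := by
        intro k
        induction k with
        | zero => simp
        | succ k ih =>
          rw [pow_succ, pow_succ', mul_assoc, ← mul_assoc (elD K n i), elD_mul_elI, one_mul, ih]
      exact ⟨ε * elI K n i ^ k, by
        rw [List.prod_cons, mul_assoc, ← mul_assoc l.prod, hε, one_mul, hx]⟩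
  refine key _ fun x hx => ?_
  obtain ⟨i, rfl⟩ := (List.mem_ofFn' _ _).1 hx
  exact ⟨i, _, rfl⟩

theorem elDelta_exists_pow_mul_mem (a : intDiffAlg K n) :
    ∃ k : ℕ, elDelta K n ^ k * a ∈ algDelta K n := by
  have hδ : elDelta K n ∈ algDelta K n := elDD_mem_algDelta _
  induction a using intDiffAlg_induction with
  | hX i => exact ⟨1, by
      rw [pow_one, elDelta_mul_elX]; exact mul_mem (elDD_mem_algDelta _) (elH_mem_algDelta i)⟩
  | hD i => exact ⟨0, by rw [pow_zero, one_mul]; exact elD_mem_algDelta i⟩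
  | hI i => exact ⟨1, by rw [pow_one, elDelta_mul_elI]; exact elDD_mem_algDelta _⟩
  | hc c => exact ⟨0, by rw [pow_zero, one_mul]; exact Subalgebra.algebraMap_mem _ c⟩
  | hadd a b ha hb =>
    obtain ⟨k, hk⟩ := ha
    obtain ⟨l, hl⟩ := hb
    refine ⟨l + k, ?_⟩
    rw [mul_add]
    nth_rewrite 1 [pow_add]
    rw [add_comm l k, pow_add, mul_assoc, mul_assoc]
    exact add_mem (mul_mem (pow_mem hδ l) hk) (mul_mem (pow_mem hδ k) hl)
  | hmul a b ha hb =>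
    obtain ⟨k, hk⟩ := ha
    obtain ⟨l, hl⟩ := hb
    obtain ⟨d, hd, e⟩ := exists_pow_mul_eq_mul_pow (K := K) (R := intDiffAlg K n)
      (fun _ => elDelta_mul_comm_left) hk l
    refine ⟨l + k, ?_⟩
    rw [pow_add, mul_assoc, ← mul_assoc _ a, ← mul_assoc, e, mul_assoc]
    exact mul_mem hd hl

/-- `B_n` is `Δ_n` with `∂_1 ⋯ ∂_n` inverted. -/
theorem isLeftOreFrame_algDelta : IsLeftOreFrame (algDelta K n) (elDelta K n) where
  mem := elDD_mem_algDelta _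
  mul_comm_left _ := elDelta_mul_comm_left
  mul_comm_right _ := elDelta_mul_comm_right
  right_inv := elDelta_right_inv
  exists_pow_mul_mem := elDelta_exists_pow_mul_mem
  domain _ ha _ hb := algDelta_eq_zero_or_eq_zero ha hb
  ore _ hr _ hs := algDelta_ore hr hs

/-- For elements of the Weyl algebra, powers of `∂_1 ⋯ ∂_n` on the right also suffice, because
`x_i ∂_i = H_i - 1`; for `∫_i` this fails. -/
theorem weylIncl_exists_mul_pow_mem (w : weylAlg K n) :
    ∃ k : ℕ, weylIncl K n w * elDelta K n ^ k ∈ algDelta K n := by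
  have F := isLeftOreFrame_algDelta (K := K) (n := n)
  induction w using weylAlg_induction with
  | hX i h =>
    refine ⟨1, ?_⟩
    change elX K n i * _ ∈ _
    rw [pow_one, elX_mul_elDelta]
    exact mul_mem (elH_sub_one_mem_algDelta i) (elDD_mem_algDelta _)
  | hD i h =>
    refine ⟨0, ?_⟩
    change elD K n i * _ ∈ _
    rw [pow_zero, mul_one]
    exact elD_mem_algDelta i
  | hc c =>
    refine ⟨0, ?_⟩
    rw [pow_zero, mul_one, AlgHom.commutes]
    exact Subalgebra.algebraMap_mem _ c
  | hadd a b ha hb =>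
    obtain ⟨k, hk⟩ := ha
    obtain ⟨l, hl⟩ := hb
    refine ⟨k + l, ?_⟩
    rw [map_add, add_mul, pow_add, ← mul_assoc, ← pow_add, add_comm k l, pow_add, ← mul_assoc]
    exact add_mem (mul_mem hk (pow_mem F.mem l)) (mul_mem hl (pow_mem F.mem k))
  | hmul a b ha hb =>
    obtain ⟨k, hk⟩ := ha
    obtain ⟨l, hl⟩ := hb
    obtain ⟨d, hd, e⟩ := F.pow_mul_comm_right hl k
    refine ⟨l + k, ?_⟩
    rw [map_mul, pow_add, mul_assoc, ← mul_assoc _ (elDelta K n ^ l), e, ← mul_assoc]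
    exact mul_mem hk hd

/-- `A_n ∩ 𝔞_n = 0`: right multiplication by a power of `∂_1 ⋯ ∂_n` moves an element of the
intersection into the domain `Δ_n`. -/
theorem weylIncl_eq_zero (w : weylAlg K n) (hw : IsPowTorsion (elDelta K n) (weylIncl K n w)) :
    w = 0 := by
  have : Nontrivial (intDiffAlg K n) := inferInstance
  have F := isLeftOreFrame_algDelta (K := K) (n := n)
  obtain ⟨k, hk⟩ := weylIncl_exists_mul_pow_mem w
  have h0 : weylIncl K n w = 0 := F.pow_mem_leftRegular k _ ((hw.mul_right _).eq_zero F hk)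
  exact Subalgebra.inclusion_injective _ (h0.trans (map_zero _).symm)

/-- In `B_n` the `∂_i` are units, since `∫_i ∂_i = 1 - e_{00}(i)`. -/
theorem isUnit_toB_elD (i : Fin n) : IsUnit (toB K n (elD K n i)) := by
  have h : toB K n (1 - elI K n i * elD K n i) = 0 := by
    rw [toB_eq_zero_iff_mem]
    refine (le_iSup (idealP K n) i : idealP K n i ≤ idealA K n)
      (TwoSidedIdeal.subset_span ⟨0, 0, ?_⟩)
    simp [elE]
  replace h := (map_sub (toB K n) _ _).symm.trans h
  rw [sub_eq_zero, map_one, map_mul] at h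
  exact ⟨⟨_, toB K n (elI K n i), by rw [← map_mul, elD_mul_elI, map_one], h.symm⟩, rfl⟩

/-- The ideal `𝔞_n` consists of the elements killed by a power of `∂_1 ⋯ ∂_n`. -/
theorem toB_eq_zero_iff (a : intDiffAlg K n) :
    toB K n a = 0 ↔ IsPowTorsion (elDelta K n) a := by
  have F := isLeftOreFrame_algDelta (K := K) (n := n)
  constructor
  · rw [toB_eq_zero_iff_mem]
    let J : TwoSidedIdeal (intDiffAlg K n) := TwoSidedIdeal.mk' {a | IsPowTorsion (elDelta K n) a}
      IsPowTorsion.zero (fun ha hb => ha.add hb) (fun ha => ha.neg)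
      (fun {x _} ha => IsPowTorsion.mul_left F ha x) (fun {_ y} ha => ha.mul_right y)
    have hmem : ∀ a, a ∈ J ↔ IsPowTorsion (elDelta K n) a := fun a =>
      TwoSidedIdeal.mem_mk' _ _ _ _ _ _ a
    have hJ : idealA K n ≤ J := by
      refine iSup_le fun i => TwoSidedIdeal.span_le.2 ?_
      rintro _ ⟨s, t, rfl⟩
      refine (hmem _).2 ⟨s + 1, ext_rightAct fun u => ?_⟩
      -- `(∂_1 ⋯ ∂_n)^{s + 1}` maps into the monomials with exponent `> s`, which `e_{st}(i)` kills.
      have hk : ∀ k : ℕ, ∃ v : Fin n →₀ ℕ, k ≤ v i ∧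
          rightAct (elDelta K n ^ k) (monomial u (1 : K)) = monomial v 1 := by
        intro k
        induction k with
        | zero => exact ⟨u, Nat.zero_le _, by rw [pow_zero, rightAct_one, Module.End.one_apply]⟩
        | succ k ih =>
          obtain ⟨v, hv, e⟩ := ih
          refine ⟨v + Finsupp.equivFunOnFinite.symm 1, by simpa using hv, ?_⟩
          rw [pow_succ, rightAct_mul_apply, e, rightAct_elDelta_monomial]
      obtain ⟨v, hv, e⟩ := hk (s + 1)
      rw [rightAct_mul_apply, e, rightAct_elE_monomial, if_neg (by omega), rightAct_zero,
        LinearMap.zero_apply]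
    exact fun ha => (hmem a).1 (hJ ha)
  · rintro ⟨k, hk⟩
    have hu : IsUnit (toB K n (elDelta K n)) := by
      rw [elDelta, elDD, map_list_prod]
      refine List.prod_isUnit fun x hx => ?_
      obtain ⟨y, hy, rfl⟩ := List.mem_map.1 hx
      obtain ⟨i, rfl⟩ := (List.mem_ofFn' _ _).1 hy
      rw [map_pow]
      exact (isUnit_toB_elD i).pow _
    have := congrArg (toB K n) hk
    rw [map_mul, map_pow, map_zero] at this
    exact (hu.pow k).mul_right_eq_zero.1 this

end Frame

/-! ### The equivalences -/

/-- The Weyl algebra is a left Ore domain, as it contains `Δ_n` and meets `𝔞_n` trivially. -/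
theorem isLeftDenominator_weylAlg {K : Type*} [Field K] [CharZero K] {n : ℕ} :
    IsLeftDenominator (R := weylAlg K n) (nonZeroDivisors (weylAlg K n)) :=
  @IsLeftOreFrame.isLeftDenominator_of_embedding K (intDiffAlg K n) _ _ _ (algDelta K n)
    (elDelta K n) _ isLeftOreFrame_algDelta (weylAlg K n) _ _ (weylIncl K n)
    (fun w hw => weylIncl_eq_zero w hw) algDelta_le_range_weylIncl

theorem mainTheorem3 (K : Type*) [Field K] [CharZero K] (n : ℕ) :
    ∃ hA : IsLeftDenominator (R := weylAlg K n) (nonZeroDivisors (weylAlg K n)),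
      List.TFAE [
        Nonempty (LeftRegQuotient (intDiffAlg K n) ≃+* LeftQuotient _ hA),
        Nonempty (LeftRegQuotient (intDiffAlg K n) ≃ₐ[K] LeftQuotient _ hA),
        ∃ h : IsLeftDenominator (leftRegular (intDiffAlg K n)),
          Nonempty (LeftQuotient _ h ≃+* LeftQuotient _ hA),
        ∃ h : IsLeftDenominator (leftRegular (intDiffAlg K n)),
          Nonempty (LeftQuotient _ h ≃ₐ[K] LeftQuotient _ hA),
        IsLeftDense (toB K n '' (leftRegDenominator (intDiffAlg K n))) {b | b ≠ 0},
        IsLeftDense (toB K n '' (leftRegular (intDiffAlg K n))) {b | b ≠ 0},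
        IsLeftDense (toB K n '' leftDelta K n) {b | b ≠ 0},
        IsLeftDense {d : algDelta K n | (d : intDiffAlg K n) ∈ leftDelta K n} {d | d ≠ 0},
        ∀ s ∈ algDelta K n, s ≠ 0 → ∃ s' ∈ algDelta K n, s' ≠ 0 ∧ s' * s ∈ leftRegularF K n,
        ∀ s ∈ algDelta K n, s ≠ 0 → ∃ s' ∈ algDelta K n, s' ≠ 0 ∧
          s' * s ∈ leftRegularOn (intDiffAlg K n) (RightP K n)] ∧
      (IsSimpleModule (intDiffAlg K n)ᵐᵒᵖ (RightP K n) ∧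
        FaithfulSMul (intDiffAlg K n)ᵐᵒᵖ (RightP K n) ∧
        ∀ (M : Type*) [AddCommGroup M] [Module (intDiffAlg K n)ᵐᵒᵖ M],
          IsSimpleModule (intDiffAlg K n)ᵐᵒᵖ M → FaithfulSMul (intDiffAlg K n)ᵐᵒᵖ M →
            Nonempty (M ≃ₗ[(intDiffAlg K n)ᵐᵒᵖ] RightP K n)) := by
  refine ⟨isLeftDenominator_weylAlg, ?_, isSimpleModule_rightP, faithfulSMul_rightP,
    fun M _ _ hs hf => nonempty_equiv_rightP M hs hf⟩
  have T := @IsLeftOreFrame.tfae K (intDiffAlg K n) _ _ _ (algDelta K n) (elDelta K n) _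
    isLeftOreFrame_algDelta (weylAlg K n) _ _ (weylIncl K n) (fun w hw => weylIncl_eq_zero w hw)
    algDelta_le_range_weylIncl isLeftDenominator_weylAlg (algB K n) _ (toB K n)
    (RingCon.mk'_surjective _) (fun a => toB_eq_zero_iff a)
  have hF : leftRegularF K n = leftRegular (intDiffAlg K n) :=
    Set.ext fun a => (mem_leftRegular_tfae a).out 1 0
  have hP : leftRegularOn (intDiffAlg K n) (RightP K n) = leftRegular (intDiffAlg K n) :=
    Set.ext fun a => (mem_leftRegular_tfae a).out 2 0
  rw [hF, hP]
  tfae_have 1 ↔ 2 := T.out 0 1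
  tfae_have 1 ↔ 3 := T.out 0 2
  tfae_have 1 ↔ 4 := T.out 0 3
  tfae_have 1 ↔ 5 := T.out 0 4
  tfae_have 1 ↔ 6 := T.out 0 5
  tfae_have 1 ↔ 7 := T.out 0 6
  tfae_have 1 ↔ 8 := T.out 0 7
  tfae_have 1 ↔ 9 := T.out 0 8
  tfae_have 1 ↔ 10 := T.out 0 8
  tfae_finish
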